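/- Let $p$ be a prime, $N\in\mathbb N$, and let $w=a_1a_2a_3\ldots$ be an infinite word over the alphabet $\mathcal A_N=\{1,\dots,N\}$. Let $P(w,n)$ be the number of distinct blocks of length $n$ occurring in $w$. For $a\in\mathbb N$ put $A_a=\begin{pmatrix}0&1\\1&a\end{pmatrix}$, acting on $\mathbf P^1(\mathbb Q_p)$, and let $\mathrm T(w,\mathbf q)=(a_2a_3\ldots,\,A_{a_1}\mathbf q)$ for $\mathbf q\in\mathbf P^1(\mathbb Q_p)$. For $\epsilon>0$ let $\mathbf{PBad}_\epsilon$ be the set of points $\mathbf q=(q_1:q_2)\in\mathbf P^1(\mathbb Q_p)$ such that $$\frac{|aq_1+bq_2|_p}{\max\{|q_1|_p,|q_2|_p\}}\ \ge\ \frac{\epsilon}{\max\{a^2,b^2\}}\qquad\text{for all }(a,b)\in\mathbb Z^2\setminus\{(0,0)\}.$$ Let $\mathbf{LMad}$ be the set of pairs $(v,\mathbf q)$, with $v$ an infinite word of positive integers and $\mathbf q\in\mathbf P^1(\mathbb Q_p)$, for which there is $\epsilon>0$ such that $\mathrm T^n(v,\mathbf q)\in\mathcal A_{\lfloor 1/\epsilon\rfloor+1}^{\mathbb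 N}\times\mathbf{PBad}_\epsilon$ for all $n\ge 0$. **Theorem.** Suppose that $w$ is not eventually periodic and that there is a constant $C>0$ with $P(w,n)\le n+C$ for all $n\ge1$. Then $(w,\mathbf x_p)\notin\mathbf{LMad}$ for every $\mathbf x_p\in\mathbf P^1(\mathbb Q_p)$. In particular, this holds for every Sturmian word $w$ over $\mathcal A_N$, i.e. every $w$ with $P(w,n)=n+1$ for all $n\ge 0$. -/

import Mathlib

open scoped LinearAlgebra.Projectivization

noncomputable section

namespace LimitMad

/-- The projective line over the field of `p`-adic numbers. -/
abbrev P1 (p : ℕ) [Fact p.Prime] : Type := ℙ ℚ_[p] (Fin 2 → ℚ_[p])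

/-- The matrix `A_a = (0 1; 1 a)`. -/
def letterMatrix (p : ℕ) [Fact p.Prime] (a : ℕ) : Matrix (Fin 2) (Fin 2) ℚ_[p] :=
  !![0, 1; 1, (a : ℚ_[p])]

theorem letterMatrix_injective (p : ℕ) [Fact p.Prime] (a : ℕ) :
    Function.Injective (Matrix.toLin' (letterMatrix p a)) := by
  rw [← LinearMap.ker_eq_bot, LinearMap.ker_eq_bot']
  intro v hv
  have h0 := congrFun hv 0
  have h1 := congrFun hv 1
  simp [letterMatrix, Matrix.mulVec, dotProduct, Fin.sum_univ_two] at h0 h1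
  funext i
  fin_cases i
  · simpa [h0] using h1
  · simpa using h0

/-- The action of `A_a` on column vectors, passed to the projective line. -/
def letterAct (p : ℕ) [Fact p.Prime] (a : ℕ) : P1 p → P1 p :=
  Projectivization.map (Matrix.toLin' (letterMatrix p a)) (letterMatrix_injective p a)

/-- The extended left shift `T(w, q) = (T w, A_{a₁} q)` on pairs of an infinite word
`w = a₁ a₂ a₃ …` and a point of the projective line; the letter `a_{i+1}` is `w i`. -/
def shift (p : ℕ) [Fact p.Prime] (x : (ℕ → ℕ) × P1 p) : (ℕ → ℕ) × P1 p :=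
  (fun i => x.1 (i + 1), letterAct p (x.1 0) x.2)

/-- The inequalities `|a q₁ + b q₂|_p · min(|q₁⁻¹|_p, |q₂⁻¹|_p) ≥ min(|a|⁻², |b|⁻²) · ε` for all
integer pairs `(a, b) ≠ (0, 0)`. Since the inverse of `0` counts as infinite in both minima, they
are written as `1 / max(|q₁|_p, |q₂|_p)` and `1 / max(a², b²)`. -/
def PBadVec (p : ℕ) [Fact p.Prime] (ε : ℝ) (q : Fin 2 → ℚ_[p]) : Prop :=
  ∀ a b : ℤ, (a, b) ≠ (0, 0) →
    ε / max ((a : ℝ) ^ 2) ((b : ℝ) ^ 2) ≤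
      ‖(a : ℚ_[p]) * q 0 + (b : ℚ_[p]) * q 1‖ / max ‖q 0‖ ‖q 1‖

/-- The points `q` of the projective line that are `p`-adically badly approximable with
constant `ε`. The choice of homogeneous coordinates is immaterial, see `mk_mem_PBad`. -/
def PBad (p : ℕ) [Fact p.Prime] (ε : ℝ) : Set (P1 p) :=
  {x | PBadVec p ε x.rep}

theorem PBadVec_smul (p : ℕ) [Fact p.Prime] (ε : ℝ) (c : ℚ_[p]) (hc : c ≠ 0)
    (q : Fin 2 → ℚ_[p]) : PBadVec p ε (c • q) ↔ PBadVec p ε q := by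
  have hc' : 0 < ‖c‖ := norm_pos_iff.mpr hc
  unfold PBadVec
  refine forall_congr' fun a => forall_congr' fun b => imp_congr_right fun _ => ?_
  have h1 : (a : ℚ_[p]) * (c • q) 0 + (b : ℚ_[p]) * (c • q) 1
      = c * ((a : ℚ_[p]) * q 0 + (b : ℚ_[p]) * q 1) := by
    simp only [Pi.smul_apply, smul_eq_mul]; ring
  have h2 : max ‖(c • q) 0‖ ‖(c • q) 1‖ = ‖c‖ * max ‖q 0‖ ‖q 1‖ := by
    simp only [Pi.smul_apply, smul_eq_mul, norm_mul]
    rw [mul_max_of_nonneg _ _ hc'.le]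
  rw [h1, h2, norm_mul, mul_div_mul_left _ _ hc'.ne']

theorem mk_mem_PBad (p : ℕ) [Fact p.Prime] (ε : ℝ) (q : Fin 2 → ℚ_[p]) (hq : q ≠ 0) :
    Projectivization.mk ℚ_[p] q hq ∈ PBad p ε ↔ PBadVec p ε q := by
  obtain ⟨c, hc⟩ := Projectivization.exists_smul_eq_mk_rep ℚ_[p] q hq
  have h : PBadVec p ε ((c : ℚ_[p]) • q) ↔ PBadVec p ε q :=
    PBadVec_smul p ε c c.ne_zero q
  have hc' : (c : ℚ_[p]) • q = (Projectivization.mk ℚ_[p] q hq).rep := hc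
  rw [hc'] at h
  exact h

/-- All letters of the word `w` lie in the alphabet `{1, 2, …, N}`. -/
def InAlphabet (N : ℕ) (w : ℕ → ℕ) : Prop :=
  ∀ i, w i ∈ Set.Icc 1 N

/-- The pairs `x = (w, q)` with `Tⁿ x ∈ {1, …, N}^ℕ × PBad_ε` for all `n`, where
`N = ⌊1/ε⌋ + 1`. -/
def LMadEps (p : ℕ) [Fact p.Prime] (ε : ℝ) : Set ((ℕ → ℕ) × P1 p) :=
  {x | ∀ n : ℕ, InAlphabet (⌊ε⁻¹⌋₊ + 1) ((shift p)^[n] x).1 ∧ ((shift p)^[n] x).2 ∈ PBad p ε}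

/-- The set **LMad**. -/
def LMad (p : ℕ) [Fact p.Prime] : Set ((ℕ → ℕ) × P1 p) :=
  {x | ∃ ε : ℝ, 0 < ε ∧ x ∈ LMadEps p ε}

/-- The set of blocks of length `n` that occur in the word `w`. -/
def blocks (w : ℕ → ℕ) (n : ℕ) : Set (Fin n → ℕ) :=
  Set.range fun i : ℕ => fun j : Fin n => w (i + j)

/-- The complexity `P(w, n)` of a word `w` over a finite alphabet: the number of distinct blocks
of length `n` that occur in `w`. -/
def complexity (w : ℕ → ℕ) (n : ℕ) : ℕ := (blocks w n).ncard

/-- `w` is periodic from some place on. -/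
def EventuallyPeriodic (w : ℕ → ℕ) : Prop :=
  ∃ m l : ℕ, 0 < l ∧ ∀ i, m ≤ i → w (i + l) = w i

/-- Sturmian words: words with exactly `n + 1` blocks of each length `n`. -/
def IsSturmian (w : ℕ → ℕ) : Prop :=
  ∀ n : ℕ, complexity w n = n + 1

end LimitMad

end

/-! A tail of `w` is recurrent and has, for each large `n`, exactly one right special block of
length `n`, continued by two letters `a` and `b` (`exists_frame_tail`). Between consecutive
occurrences of that block the word is a loop determined by its first letter, so the product of
letter matrices gets multiplied by one of two elements of GL₂(ℤ). As `n` grows, this pair stays the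
same or changes by (g, g') ↦ (g, gg') or (g'g, g'); hence it always generates the same group H.

Modulo p^k, the products occurring infinitely often at special positions form sets that decrease
with `n` and stabilise; the final set is invariant under a generating pair of H, so it contains a
coset of the image of H (`exists_cocycle_eq`). By compactness, a point of **LMad** then yields a
vector z whose whole H-orbit is uniformly badly approximable (`exists_badOn_of_forall_congr`).

This is impossible. If g ∈ H is 1 modulo p² and z is not an eigenvector of g, pick an integer row
(a, b) nearly orthogonal to z; a Hensel-type iteration finds n for which the value of (a, b) on gⁿz
is arbitrarily small (`exists_lt_of_not_eigenvector`). So z is an eigenvector of a fixed power of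
every element of H. Its coordinates are linearly independent over ℤ, so these powers commute
(`commute_of_badOn`). But long products of letter matrices determine their rightmost factor, and the
loop matrices have A_a and A_b there, so a = b (`letter_eq_of_commute`). -/

namespace LimitMad

/-! ### Right special positions of a word -/

/-- The `n` letters before position `s` exist and agree with those before position `t`. -/
def PastEq (w : ℕ → ℕ) (n s t : ℕ) : Prop :=
  n ≤ s ∧ n ≤ t ∧ ∀ j < n, w (s - (j + 1)) = w (t - (j + 1))

/-- The positions of `w` that are preceded by a right special block of length `n`. -/
def special (w : ℕ → ℕ) (n : ℕ) : Set ℕ :=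
  {t | ∃ s, PastEq w n s t ∧ w s ≠ w t}

/-- `s` and `t` are consecutive positions preceded by a right special block of length `n`. -/
def IsNext (w : ℕ → ℕ) (n s t : ℕ) : Prop :=
  s ∈ special w n ∧ t ∈ special w n ∧ s < t ∧ ∀ r, s < r → r < t → r ∉ special w n

section
variable {w : ℕ → ℕ} {n m s t r : ℕ}

theorem PastEq.symm (h : PastEq w n s t) : PastEq w n t s :=
  ⟨h.2.1, h.1, fun j hj => (h.2.2 j hj).symm⟩

theorem PastEq.trans (h : PastEq w n r s) (h' : PastEq w n s t) : PastEq w n r t :=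
  ⟨h.1, h'.2.1, fun j hj => (h.2.2 j hj).trans (h'.2.2 j hj)⟩

theorem PastEq.mono (hmn : m ≤ n) (h : PastEq w n s t) : PastEq w m s t :=
  ⟨hmn.trans h.1, hmn.trans h.2.1, fun j hj => h.2.2 j (hj.trans_le hmn)⟩

theorem PastEq.succ (h : PastEq w n s t) (hw : w s = w t) :
    PastEq w (n + 1) (s + 1) (t + 1) := by
  refine ⟨Nat.succ_le_succ h.1, Nat.succ_le_succ h.2.1, fun j hj => ?_⟩
  rcases j with _ | j
  · simpa using hw
  · simpa using h.2.2 j (by omega)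

theorem pastEq_of_window {i j d : ℕ} (h : ∀ k < n + d, w (j + k) = w (i + k)) :
    PastEq w n (j + n) (i + n) := by
  refine ⟨by omega, by omega, fun k hk => ?_⟩
  have := h (n - (k + 1)) (by omega)
  rwa [← Nat.add_sub_assoc (by omega), ← Nat.add_sub_assoc (by omega)] at this

theorem mem_special_of_pastEq (ht : t ∈ special w n) (h : PastEq w n t s) : s ∈ special w n := by
  obtain ⟨r, hr, hne⟩ := ht
  by_cases hw : w t = w s
  · exact ⟨r, hr.trans h, hw ▸ hne⟩
  · exact ⟨t, h, hw⟩

theorem special_anti (hmn : m ≤ n) : special w n ⊆ special w m := by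
  rintro t ⟨s, hs, hne⟩
  exact ⟨s, hs.mono hmn, hne⟩

theorem eq_of_notMem_special (ht : t ∉ special w n) (h : PastEq w n s t) : w s = w t := by
  by_contra hne
  exact ht ⟨s, h, hne⟩

theorem le_of_mem_special (ht : t ∈ special w n) : n ≤ t := by
  obtain ⟨s, hs, -⟩ := ht
  exact hs.2.1

theorem IsNext.unique {t' : ℕ} (h : IsNext w n s t) (h' : IsNext w n s t') : t = t' := by
  rcases lt_trichotomy t t' with hlt | heq | hlt
  · exact absurd h.2.1 (h'.2.2.2 t h.2.2.1 hlt)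
  · exact heq
  · exact absurd h'.2.1 (h.2.2.2 t' h'.2.2.1 hlt)

theorem exists_isNext_left (ht : t ∈ special w n) (hr : r ∈ special w n) (hrt : r < t) :
    ∃ s, r ≤ s ∧ IsNext w n s t := by
  classical
  let s := Nat.findGreatest (fun s => s ∈ special w n) (t - 1)
  have hs : s ∈ special w n :=
    Nat.findGreatest_spec (P := fun s => s ∈ special w n) (m := r) (by omega) hr
  have hrs : r ≤ s := Nat.le_findGreatest (by omega) hr
  have hst : s ≤ t - 1 := Nat.findGreatest_le _
  refine ⟨s, hrs, hs, ht, by omega, fun q hq hqt => ?_⟩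
  exact Nat.findGreatest_is_greatest hq (by omega)

theorem exists_isNext_right (hs : s ∈ special w n) (hinf : ∀ N, ∃ t ≥ N, t ∈ special w n) :
    ∃ t, IsNext w n s t := by
  classical
  have hex : ∃ t, s < t ∧ t ∈ special w n := by
    obtain ⟨t, ht, h⟩ := hinf (s + 1)
    exact ⟨t, ht, h⟩
  refine ⟨Nat.find hex, hs, (Nat.find_spec hex).2, (Nat.find_spec hex).1, fun r hr hlt hm => ?_⟩
  exact Nat.find_min hex hlt ⟨hr, hm⟩

/-- The word read between consecutive special positions is determined by its first letter. -/
theorem IsNext.transport {s' : ℕ} (h : IsNext w n s t) (hp : PastEq w n s s')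
    (hw : w s = w s') :
    IsNext w n s' (s' + (t - s)) ∧ PastEq w (n + 1) t (s' + (t - s)) ∧
      ∀ k < t - s, w (s + k) = w (s' + k) := by
  obtain ⟨hs, ht, hst, hmin⟩ := h
  -- No position strictly inside the loop is special, so each next letter is forced. The common past
  -- has length `n + 1`, not just `n`, because the letters at `s` and `s'` agree too.
  have key : ∀ k, s + k < t →
      PastEq w (n + 1) (s + k + 1) (s' + k + 1) ∧ w (s + k) = w (s' + k) := by
    intro k
    induction k with
    | zero => exact fun _ => ⟨hp.succ hw, hw⟩
    | succ k ih =>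
      intro hk
      obtain ⟨h1, -⟩ := ih (by omega)
      have h2 : PastEq w n (s + k + 1) (s' + k + 1) := h1.mono (by omega)
      have h3 := eq_of_notMem_special (hmin (s + k + 1) (by omega) (by omega)) h2.symm
      exact ⟨h2.succ h3.symm, h3.symm⟩
  have hend : PastEq w (n + 1) t (s' + (t - s)) := by
    have := (key (t - s - 1) (by omega)).1
    rwa [show s + (t - s - 1) + 1 = t by omega,
      show s' + (t - s - 1) + 1 = s' + (t - s) by omega] at this
  refine ⟨⟨mem_special_of_pastEq hs hp,
    mem_special_of_pastEq ht (hend.mono (by omega)), by omega, fun r hr hrt hmem => ?_⟩, hend,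
    fun k hk => (key k (by omega)).2⟩
  have := (key (r - s' - 1) (by omega)).1.mono (Nat.le_succ n)
  rw [show s' + (r - s' - 1) + 1 = r by omega] at this
  exact hmin _ (by omega) (by omega) (mem_special_of_pastEq hmem this.symm)

end

/-! ### Recurrent words with one right special block of each large length -/

/-- `w` is recurrent and not periodic, and for `n ≥ n₀` it has exactly one right special block
of length `n`, which is followed by the letters `a` and `b` only. -/
structure Frame (w : ℕ → ℕ) (n₀ a b : ℕ) : Prop where
  recurrent : ∀ i n N, ∃ j ≥ N, ∀ k < n, w (j + k) = w (i + k)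
  aperiodic : ¬ ∃ d, 0 < d ∧ ∀ i, w (i + d) = w i
  ne : a ≠ b
  unique : ∀ n ≥ n₀, ∀ s ∈ special w n, ∀ t ∈ special w n, PastEq w n s t
  letter : ∀ n ≥ n₀, ∀ t ∈ special w n, w t = a ∨ w t = b
  nonempty : ∀ n ≥ n₀, (special w n).Nonempty

/-- Along each loop that starts with `c`, the right special block of length `n` at the end can be
prolonged to the left to the right special block of length `n + 1`. -/
def EndsIn (w : ℕ → ℕ) (n c : ℕ) : Prop :=
  ∀ s t, IsNext w n s t → w s = c → t ∈ special w (n + 1)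

/-- The product of the group elements attached to the letters before position `t`. -/
def cocycle {Γ : Type*} [Group Γ] (γ : ℕ → Γ) (w : ℕ → ℕ) : ℕ → Γ
  | 0 => 1
  | t + 1 => γ (w t) * cocycle γ w t

/-- The loops that start with `c` at level `n` multiply the cocycle by `g`. -/
def Trans {Γ : Type*} [Group Γ] (γ : ℕ → Γ) (w : ℕ → ℕ) (n c : ℕ) (g : Γ) : Prop :=
  ∀ s t, IsNext w n s t → w s = c → cocycle γ w t = g * cocycle γ w s

namespace Frame
variable {w : ℕ → ℕ} {n₀ a b n : ℕ}

theorem symm (F : Frame w n₀ a b) : Frame w n₀ b a where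
  recurrent := F.recurrent
  aperiodic := F.aperiodic
  ne := F.ne.symm
  unique := F.unique
  letter n hn t ht := (F.letter n hn t ht).symm
  nonempty := F.nonempty

theorem exists_mem_special_eq_left (F : Frame w n₀ a b) (hn : n₀ ≤ n) (N : ℕ) :
    ∃ t ≥ N, t ∈ special w n ∧ w t = a := by
  obtain ⟨t, s, hst, hne⟩ := F.nonempty n hn
  have ht : t ∈ special w n := ⟨s, hst, hne⟩
  have hs : s ∈ special w n := ⟨t, hst.symm, hne.symm⟩
  obtain ⟨r, hr, hra⟩ : ∃ r ∈ special w n, w r = a := by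
    rcases F.letter n hn t ht with h | h
    · exact ⟨t, ht, h⟩
    · rcases F.letter n hn s hs with h' | h'
      · exact ⟨s, hs, h'⟩
      · exact absurd (h'.trans h.symm) hne
  have hnr := le_of_mem_special hr
  obtain ⟨j, hj, hjk⟩ := F.recurrent (r - n) (n + 1) N
  have hp := pastEq_of_window hjk
  rw [Nat.sub_add_cancel hnr] at hp
  refine ⟨j + n, by omega, mem_special_of_pastEq hr hp.symm, ?_⟩
  rw [hjk n (by omega), Nat.sub_add_cancel hnr, hra]

theorem exists_mem_special_ge (F : Frame w n₀ a b) (hn : n₀ ≤ n) (N : ℕ) :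
    ∃ t ≥ N, t ∈ special w n := by
  obtain ⟨t, ht, h, -⟩ := F.exists_mem_special_eq_left hn N
  exact ⟨t, ht, h⟩

theorem exists_isNext (F : Frame w n₀ a b) (hn : n₀ ≤ n) {s : ℕ} (hs : s ∈ special w n) :
    ∃ t, IsNext w n s t :=
  exists_isNext_right hs (F.exists_mem_special_ge hn)

theorem exists_isNext_eq_left (F : Frame w n₀ a b) (hn : n₀ ≤ n) :
    ∃ s t, IsNext w n s t ∧ w s = a := by
  obtain ⟨s, -, hs, hsa⟩ := F.exists_mem_special_eq_left hn 0
  obtain ⟨t, ht⟩ := F.exists_isNext hn hs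
  exact ⟨s, t, ht, hsa⟩

theorem transport (F : Frame w n₀ a b) (hn : n₀ ≤ n) {s t s' t' : ℕ} (h : IsNext w n s t)
    (h' : IsNext w n s' t') (hw : w s = w s') :
    t' = s' + (t - s) ∧ PastEq w (n + 1) t t' ∧ ∀ k < t - s, w (s + k) = w (s' + k) := by
  obtain ⟨h1, h2, h3⟩ := h.transport (F.unique n hn s h.1 s' h'.1) hw
  have h4 := h'.unique h1
  exact ⟨h4, h4 ▸ h2, h3⟩

/-- Ends of loops with the same first letter share a past of length `n + 1`, so one failure forces
failure everywhere. -/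
theorem notMem_of_not_endsIn (F : Frame w n₀ a b) (hn : n₀ ≤ n) {c : ℕ} (hc : ¬ EndsIn w n c)
    {s t : ℕ} (h : IsNext w n s t) (hs : w s = c) : t ∉ special w (n + 1) := by
  simp only [EndsIn, not_forall] at hc
  obtain ⟨s', t', h', hs', ht'⟩ := hc
  exact fun ht => ht' (mem_special_of_pastEq ht (F.transport hn h h' (hs.trans hs'.symm)).2.1)

theorem endsIn_or (F : Frame w n₀ a b) (hn : n₀ ≤ n) : EndsIn w n a ∨ EndsIn w n b := by
  by_contra hcon
  push Not at hcon
  obtain ⟨r, -, hr⟩ := F.exists_mem_special_ge hn 0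
  obtain ⟨t, htr, ht⟩ := F.exists_mem_special_ge (n := n + 1) (by omega) (r + 1)
  obtain ⟨s, -, hs⟩ := exists_isNext_left (special_anti (Nat.le_succ n) ht) hr (by omega)
  rcases F.letter n hn s hs.1 with h | h
  · exact F.notMem_of_not_endsIn hn hcon.1 hs h ht
  · exact F.notMem_of_not_endsIn hn hcon.2 hs h ht

/-- All `b`-loops end with the same past of length `n + 1`, which is not special and so forces the
next letter. If that letter were `b`, only `b`-loops would follow, and `a` would no longer recur. -/
theorem eq_left_of_isNext (F : Frame w n₀ a b) (hn : n₀ ≤ n) (hb : ¬ EndsIn w n b) {s t : ℕ}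
    (h : IsNext w n s t) (hs : w s = b) : w t = a := by
  refine (F.letter n hn t h.2.1).resolve_right fun htb => ?_
  have hall : ∀ r, t ≤ r → r ∈ special w n → w r = b := by
    intro r
    induction r using Nat.strong_induction_on with
    | _ r ih =>
      intro htr hr
      rcases htr.eq_or_lt with rfl | hlt
      · exact htb
      · obtain ⟨q, hq, hqr⟩ := exists_isNext_left hr h.2.1 hlt
        have hqb := ih q hqr.2.2.1 hq hqr.1
        have hp := (F.transport hn h hqr (hs.trans hqb.symm)).2.1
        exact (eq_of_notMem_special (F.notMem_of_not_endsIn hn hb h hs) hp.symm).trans htb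
  obtain ⟨r, hr, hrs, hra⟩ := F.exists_mem_special_eq_left hn t
  exact F.ne (hra.symm.trans (hall r hr hrs))

/-- Otherwise a special position followed by `b` stays special at every higher level. Two such
positions, copied far to the right, then share an arbitrarily long past by uniqueness of the special
block, which makes `w` periodic. -/
theorem exists_not_endsIn_left (F : Frame w n₀ a b) (hn : n₀ ≤ n) :
    ∃ m ≥ n, ¬ EndsIn w m a := by
  by_contra hcon
  push Not at hcon
  have stay : ∀ t ∈ special w n, w t = b → ∀ m, n ≤ m → m ≤ t → t ∈ special w m := by
    intro t ht htb m hnm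
    induction m, hnm using Nat.le_induction with
    | base => exact fun _ => ht
    | succ m hm ih =>
      intro hmt
      have htm := ih (by omega)
      obtain ⟨r, -, hr⟩ := F.exists_mem_special_ge (hn.trans hm) 0
      -- `t` itself may have no earlier special position, so the argument runs at a copy lying
      -- beyond `r`.
      obtain ⟨j, hj, hjk⟩ := F.recurrent (t - (m + 1)) (m + 1 + 1) (r + 1)
      have hp := pastEq_of_window hjk
      rw [Nat.sub_add_cancel hmt] at hp
      have hwb : w (j + (m + 1)) = b := by
        rw [hjk (m + 1) (by omega), Nat.sub_add_cancel hmt, htb]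
      refine mem_special_of_pastEq ?_ hp
      have hmem := mem_special_of_pastEq htm (hp.mono (Nat.le_succ m)).symm
      obtain ⟨s, -, hs⟩ := exists_isNext_left hmem hr (by omega)
      rcases F.letter m (hn.trans hm) s hs.1 with h | h
      · exact hcon m hm s _ hs h
      · by_cases hb : EndsIn w m b
        · exact hb s _ hs h
        · exact absurd ((F.eq_left_of_isNext (hn.trans hm) hb hs h).symm.trans hwb) F.ne
  obtain ⟨t, -, ht, htb⟩ := F.symm.exists_mem_special_eq_left hn 0
  obtain ⟨t', htt', ht', htb'⟩ := F.symm.exists_mem_special_eq_left hn (t + 1)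
  have hnt := le_of_mem_special ht
  refine F.aperiodic ⟨t' - t, by omega, fun i => ?_⟩
  obtain ⟨j, hj, hjk⟩ := F.recurrent (t - n) (n + (t' - t + 1)) (i + 1)
  have hp := pastEq_of_window hjk
  rw [Nat.sub_add_cancel hnt] at hp
  have hs := mem_special_of_pastEq ht hp.symm
  have hsb : w (j + n) = b := by
    rw [hjk n (by omega), Nat.sub_add_cancel hnt, htb]
  have hp' : PastEq w n (j + (t' - t) + n) (t' - n + n) := by
    refine pastEq_of_window (d := 0) fun k hk => ?_
    have := hjk (t' - t + k) (by omega)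
    rwa [← add_assoc, show t - n + (t' - t + k) = t' - n + k by omega] at this
  rw [Nat.sub_add_cancel (by omega)] at hp'
  have hs' := mem_special_of_pastEq ht' hp'.symm
  have hsb' : w (j + (t' - t) + n) = b := by
    have := hjk (n + (t' - t)) (by omega)
    rw [show t - n + (n + (t' - t)) = t' by omega, htb'] at this
    rw [← this]; congr 1; omega
  have h1 := stay _ hs hsb (j + n) (by omega) le_rfl
  have h2 := stay _ hs' hsb' (j + n) (by omega) (by omega)
  have := (F.unique (j + n) (by omega) _ h1 _ h2).2.2 (j + n - 1 - i) (by omega)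
  rw [show j + n - (j + n - 1 - i + 1) = i by omega,
    show j + (t' - t) + n - (j + n - 1 - i + 1) = i + (t' - t) by omega] at this
  exact this.symm

/-! ### The cocycle along loops, from level to level and in finite quotients -/

section
open scoped Pointwise

variable {Γ : Type*} [Group Γ] {γ : ℕ → Γ}

/-- Later letters multiply on the left, so the first letter of the loop is the rightmost factor. It
is kept separate because it is what the matrix argument recovers. -/
theorem exists_trans_left (γ : ℕ → Γ) (F : Frame w n₀ a b) (hn : n₀ ≤ n) :
    ∃ x ∈ Submonoid.closure (Set.range fun i => γ (w i)), Trans γ w n a (x * γ a) := by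
  obtain ⟨s, t, h, hsa⟩ := F.exists_isNext_eq_left hn
  have key : ∀ k, ∃ x ∈ Submonoid.closure (Set.range fun i => γ (w i)), ∀ s',
      (∀ i ≤ k, w (s + i) = w (s' + i)) →
      cocycle γ w (s' + k + 1) = x * γ a * cocycle γ w s' := by
    intro k
    induction k with
    | zero =>
      refine ⟨1, one_mem _, fun s' hs' => ?_⟩
      have := hs' 0 le_rfl
      simp only [add_zero] at this ⊢
      rw [cocycle, one_mul, ← this, hsa]
    | succ k ih =>
      obtain ⟨x, hx, hxs⟩ := ih
      refine ⟨γ (w (s + (k + 1))) * x,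
        mul_mem (Submonoid.subset_closure ⟨_, rfl⟩) hx, fun s' hs' => ?_⟩
      rw [cocycle, ← add_assoc, hxs s' fun i hi => hs' i (by omega), add_assoc s',
        ← hs' (k + 1) le_rfl]
      simp only [mul_assoc]
  obtain ⟨x, hx, hxs⟩ := key (t - s - 1)
  refine ⟨x, hx, fun s' t' h' hsa' => ?_⟩
  obtain ⟨h1, -, h2⟩ := F.transport hn h h' (hsa.trans hsa'.symm)
  have hlt := h.2.2.1
  rw [h1, show s' + (t - s) = s' + (t - s - 1) + 1 by omega]
  exact hxs s' fun i hi => h2 i (by omega)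

theorem trans_succ_left (F : Frame w n₀ a b) (hn : n₀ ≤ n) (ha : EndsIn w n a) {g : Γ}
    (hg : Trans γ w n a g) : Trans γ w (n + 1) a g := by
  intro s t h hsa
  obtain ⟨t', h'⟩ := F.exists_isNext hn (special_anti (Nat.le_succ n) h.1)
  have ht' := ha s t' h' hsa
  have : t = t' := by
    rcases lt_trichotomy t t' with hlt | heq | hlt
    · exact absurd (special_anti (Nat.le_succ n) h.2.1) (h'.2.2.2 t h.2.2.1 hlt)
    · exact heq
    · exact absurd ht' (h.2.2.2 t' h'.2.2.1 hlt)
  exact this ▸ hg s t' h' hsa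

/-- A `b`-loop of level `n + 1` is a `b`-loop of level `n`, whose end is no longer special, followed
by an `a`-loop. -/
theorem trans_succ_right (F : Frame w n₀ a b) (hn : n₀ ≤ n) (ha : EndsIn w n a)
    (hb : ¬ EndsIn w n b) {g g' : Γ} (hg : Trans γ w n a g) (hg' : Trans γ w n b g') :
    Trans γ w (n + 1) b (g * g') := by
  intro s t h hsb
  obtain ⟨r, hr⟩ := F.exists_isNext hn (special_anti (Nat.le_succ n) h.1)
  have hra := F.eq_left_of_isNext hn hb hr hsb
  have hrn := F.notMem_of_not_endsIn hn hb hr hsb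
  obtain ⟨t', h'⟩ := F.exists_isNext hn hr.2.1
  have ht' := ha r t' h' hra
  have : t = t' := by
    have htn := special_anti (Nat.le_succ n) h.2.1
    have hrt : r < t := by
      rcases lt_trichotomy t r with hlt | heq | hlt
      · exact absurd htn (hr.2.2.2 t h.2.2.1 hlt)
      · exact absurd (heq ▸ h.2.1) hrn
      · exact hlt
    rcases lt_trichotomy t t' with hlt | heq | hlt
    · exact absurd htn (h'.2.2.2 t hrt hlt)
    · exact heq
    · exact absurd ht' (h.2.2.2 t' (hr.2.2.1.trans h'.2.2.1) hlt)
  rw [this, hg r t' h' hra, hg' s r hr hsb, mul_assoc]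

theorem exists_trans_closure_eq (F : Frame w n₀ a b) {g g' : Γ} (hg : Trans γ w n₀ a g)
    (hg' : Trans γ w n₀ b g') (hn : n₀ ≤ n) :
    ∃ h h', Trans γ w n a h ∧ Trans γ w n b h' ∧
      Subgroup.closure {h, h'} = Subgroup.closure {g, g'} := by
  induction n, hn using Nat.le_induction with
  | base => exact ⟨g, g', hg, hg', rfl⟩
  | succ n hn ih =>
    obtain ⟨h, h', hh, hh', hcl⟩ := ih
    have hm : ∀ x y : Γ, x ∈ Subgroup.closure {x, y} ∧ y ∈ Subgroup.closure {x, y} :=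
      fun x y => ⟨Subgroup.subset_closure (by simp), Subgroup.subset_closure (by simp)⟩
    by_cases ha : EndsIn w n a
    · have h1 := F.trans_succ_left hn ha hh
      by_cases hb : EndsIn w n b
      · exact ⟨h, h', h1, F.symm.trans_succ_left hn hb hh', hcl⟩
      · refine ⟨h, h * h', h1, F.trans_succ_right hn ha hb hh hh', hcl ▸ le_antisymm ?_ ?_⟩
        · rw [Subgroup.closure_le, Set.insert_subset_iff, Set.singleton_subset_iff]
          exact ⟨(hm h h').1, mul_mem (hm h h').1 (hm h h').2⟩
        · rw [Subgroup.closure_le, Set.insert_subset_iff, Set.singleton_subset_iff]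
          refine ⟨(hm h (h * h')).1, ?_⟩
          have := mul_mem (inv_mem (hm h (h * h')).1) (hm h (h * h')).2
          rwa [inv_mul_cancel_left] at this
    · have hb := (F.endsIn_or hn).resolve_left ha
      refine ⟨h' * h, h', F.symm.trans_succ_right hn hb ha hh' hh,
        F.symm.trans_succ_left hn hb hh', hcl ▸ le_antisymm ?_ ?_⟩
      · rw [Subgroup.closure_le, Set.insert_subset_iff, Set.singleton_subset_iff]
        exact ⟨mul_mem (hm h h').2 (hm h h').1, (hm h h').2⟩
      · rw [Subgroup.closure_le, Set.insert_subset_iff, Set.singleton_subset_iff]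
        refine ⟨?_, (hm (h' * h) h').2⟩
        have := mul_mem (inv_mem (hm (h' * h) h').2) (hm (h' * h) h').1
        rwa [inv_mul_cancel_left] at this

variable {G : Type*} [Group G]

/-- The values that the cocycle takes infinitely often at special positions of level `n`. -/
def limitValues (φ : Γ →* G) (γ : ℕ → Γ) (w : ℕ → ℕ) (n : ℕ) : Set G :=
  {g | ∀ N, ∃ t ≥ N, t ∈ special w n ∧ φ (cocycle γ w t) = g}

theorem limitValues_anti (φ : Γ →* G) {m : ℕ} (hmn : m ≤ n) :
    limitValues φ γ w n ⊆ limitValues φ γ w m := by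
  intro g hg N
  obtain ⟨t, ht, hts, h⟩ := hg N
  exact ⟨t, ht, special_anti hmn hts, h⟩

variable [Finite G]

theorem limitValues_nonempty (F : Frame w n₀ a b) (φ : Γ →* G) (hn : n₀ ≤ n) :
    (limitValues φ γ w n).Nonempty := by
  by_contra hemp
  rw [Set.not_nonempty_iff_eq_empty, Set.eq_empty_iff_forall_notMem] at hemp
  simp only [limitValues, Set.mem_ofPred_eq, not_forall, not_exists, not_and] at hemp
  choose B hB using hemp
  obtain ⟨N, hN⟩ := (Set.finite_range B).bddAbove
  obtain ⟨t, ht, hts⟩ := F.exists_mem_special_ge hn N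
  exact hB _ t ((hN ⟨_, rfl⟩).trans ht) hts rfl

/-- A special position of level `n + 1` with an earlier special position of level `n` must end an
`a`-loop of level `n`. Going back along that loop multiplies the value by `(φ g)⁻¹`, so this element
maps the stable set into itself; finiteness does the rest. -/
theorem mem_stabilizer_limitValues (F : Frame w n₀ a b) (φ : Γ →* G) (hn : n₀ ≤ n)
    (hb : ¬ EndsIn w n b) {g : Γ} (hg : Trans γ w n a g)
    (hK : limitValues φ γ w (n + 1) = limitValues φ γ w n) :
    φ g ∈ MulAction.stabilizer G (limitValues φ γ w n) := by
  rw [← inv_mem_iff, MulAction.mem_stabilizer_set' (Set.toFinite _)]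
  intro x hx N
  rw [← hK] at hx
  obtain ⟨r, hrN, hr⟩ := F.exists_mem_special_ge hn N
  obtain ⟨t, ht, hts, htx⟩ := hx (r + 1)
  obtain ⟨s, hrs, hs⟩ := exists_isNext_left (special_anti (Nat.le_succ n) hts) hr (by omega)
  refine ⟨s, hrN.trans hrs, hs.1, ?_⟩
  have hsa : w s = a := (F.letter n hn s hs.1).resolve_right fun h =>
    F.notMem_of_not_endsIn hn hb hs h hts
  rw [hg s t hs hsa, map_mul] at htx
  rw [← htx, smul_eq_mul, inv_mul_cancel_left]

/-- At a level where `b`-loops fail to prolong, the `a`-element stabilises the limit set `K`. It is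
unchanged up to the first later level where `a`-loops fail, and there the `b`-element stabilises `K`
as well. This pair generates the whole group. -/
theorem exists_cocycle_eq (F : Frame w n₀ a b) (φ : Γ →* G) {g g' : Γ}
    (hg : Trans γ w n₀ a g) (hg' : Trans γ w n₀ b g') :
    ∃ s, ∀ h ∈ Subgroup.closure {g, g'}, ∃ t,
      φ (cocycle γ w t) = φ h * φ (cocycle γ w s) := by
  obtain ⟨m, hm⟩ := WellFoundedGT.monotone_chain_condition
    (⟨fun n => OrderDual.toDual (limitValues φ γ w n), fun _ _ h => limitValues_anti φ h⟩ :
      ℕ →o (Set G)ᵒᵈ)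
  have hstab : ∀ n ≥ m, limitValues φ γ w n = limitValues φ γ w m :=
    fun n hn => (hm n hn).symm
  set K := limitValues φ γ w m with hK
  obtain ⟨n, hn, hnb⟩ := F.symm.exists_not_endsIn_left (le_max_left n₀ m)
  have hn₀ : n₀ ≤ n := (le_max_left _ _).trans hn
  have hnm : m ≤ n := (le_max_right _ _).trans hn
  obtain ⟨h, -, hh, -, -⟩ := F.exists_trans_closure_eq hg hg' hn₀
  have hmem : φ h ∈ MulAction.stabilizer G K := by
    have := F.mem_stabilizer_limitValues φ hn₀ hnb hh
      ((hstab _ (by omega)).trans (hstab _ hnm).symm)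
    rwa [hstab n hnm] at this
  classical
  have hex := F.exists_not_endsIn_left hn₀
  obtain ⟨hk, hka⟩ := Nat.find_spec hex
  set k := Nat.find hex with hkdef
  have htr : ∀ q, n ≤ q → q ≤ k → Trans γ w q a h := by
    intro q hq
    induction q, hq using Nat.le_induction with
    | base => exact fun _ => hh
    | succ q hq ih =>
      intro hqk
      have hqa : EndsIn w q a := by
        by_contra hcon
        exact Nat.find_min hex (m := q) (by omega) ⟨hq, hcon⟩
      exact F.trans_succ_left (hn₀.trans hq) hqa (ih (by omega))
  have hk₀ : n₀ ≤ k := hn₀.trans hk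
  have hkm : m ≤ k := hnm.trans hk
  obtain ⟨u, u', hu, hu', hcl⟩ := F.exists_trans_closure_eq hg hg' hk₀
  have huh : u = h := by
    obtain ⟨s, t, hst, hsa⟩ := F.exists_isNext_eq_left hk₀
    exact mul_right_cancel ((hu s t hst hsa).symm.trans (htr k hk le_rfl s t hst hsa))
  have hmem' : φ u' ∈ MulAction.stabilizer G K := by
    have := F.symm.mem_stabilizer_limitValues φ hk₀ hka hu'
      ((hstab _ (by omega)).trans (hstab _ hkm).symm)
    rwa [hstab k hkm] at this
  have hle : Subgroup.closure {g, g'} ≤ (MulAction.stabilizer G K).comap φ := by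
    rw [← hcl, Subgroup.closure_le, Set.insert_subset_iff, Set.singleton_subset_iff]
    exact ⟨huh ▸ hmem, hmem'⟩
  obtain ⟨x, hx⟩ : K.Nonempty := by
    rw [← hstab n hnm]
    exact F.limitValues_nonempty φ hn₀
  obtain ⟨s, -, -, hs⟩ := hx 0
  refine ⟨s, fun y hy => ?_⟩
  have hyK : φ y • x ∈ K :=
    (MulAction.mem_stabilizer_set' (Set.toFinite K)).1 (hle hy) hx
  obtain ⟨t, -, -, ht⟩ := hyK 0
  exact ⟨t, by rw [ht, hs, smul_eq_mul]⟩

end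
end Frame
/-! ### Words of complexity `n + O(1)` -/

/-- The block of length `n` of `w` at position `i`. -/
def block (w : ℕ → ℕ) (n i : ℕ) : Fin n → ℕ := fun j => w (i + j)

section
variable {w : ℕ → ℕ} {n i j : ℕ}

theorem block_mem_blocks (w : ℕ → ℕ) (n i : ℕ) : block w n i ∈ blocks w n := ⟨i, rfl⟩

theorem block_eq_iff : block w n i = block w n j ↔ ∀ k < n, w (i + k) = w (j + k) :=
  ⟨fun h k hk => congrFun h ⟨k, hk⟩, fun h => funext fun k => h k k.2⟩

theorem init_block (w : ℕ → ℕ) (n i : ℕ) : Fin.init (block w (n + 1) i) = block w n i := rfl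

theorem image_init_blocks (w : ℕ → ℕ) (n : ℕ) :
    (Fin.init : (Fin (n + 1) → ℕ) → Fin n → ℕ) '' blocks w (n + 1) = blocks w n := by
  ext x
  constructor
  · rintro ⟨_, ⟨i, rfl⟩, rfl⟩
    exact ⟨i, rfl⟩
  · rintro ⟨i, rfl⟩
    exact ⟨_, ⟨i, rfl⟩, rfl⟩

theorem InAlphabet.finite_blocks {N : ℕ} (hw : InAlphabet N w) (n : ℕ) : (blocks w n).Finite := by
  refine (Set.Finite.pi' fun _ : Fin n => Set.finite_Icc 1 N).subset ?_
  rintro _ ⟨i, rfl⟩ j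
  exact hw _

theorem InAlphabet.tail {N : ℕ} (hw : InAlphabet N w) (i : ℕ) :
    InAlphabet N fun k => w (i + k) := fun k => hw (i + k)

theorem not_eventuallyPeriodic_tail (hper : ¬ EventuallyPeriodic w) (i : ℕ) :
    ¬ EventuallyPeriodic fun k => w (i + k) := by
  rintro ⟨m, l, hl, h⟩
  refine hper ⟨i + m, l, hl, fun k hk => ?_⟩
  have := h (k - i) (by omega)
  simp only [← add_assoc] at this
  rwa [show i + (k - i) = k by omega] at this

theorem blocks_tail_subset (w : ℕ → ℕ) (n : ℕ) (hij : i ≤ j) :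
    blocks (fun k => w (j + k)) n ⊆ blocks (fun k => w (i + k)) n := by
  rintro _ ⟨k, rfl⟩
  refine ⟨j - i + k, funext fun q => ?_⟩
  change w (i + (j - i + k + q)) = w (j + (k + q))
  congr 1
  omega

theorem EventuallyPeriodic.exists_complexity_le (h : EventuallyPeriodic w) :
    ∃ B, ∀ n, complexity w n ≤ B := by
  obtain ⟨m, l, hl, h⟩ := h
  refine ⟨m + l, fun n => ?_⟩
  have hsub : blocks w n ⊆ block w n '' (Finset.range (m + l) : Set ℕ) := by
    rintro _ ⟨i, rfl⟩
    induction i using Nat.strong_induction_on with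
    | _ i ih =>
      by_cases hi : i < m + l
      · exact ⟨i, by simpa using hi, rfl⟩
      · obtain ⟨q, hq, hqe⟩ := ih (i - l) (by omega)
        refine ⟨q, hq, hqe.trans (funext fun k => ?_)⟩
        have := h (i - l + k) (by omega)
        change w (i - l + k) = w (i + k)
        rw [← this]
        congr 1
        omega
  calc complexity w n ≤ (block w n '' (Finset.range (m + l) : Set ℕ)).ncard :=
        Set.ncard_le_ncard hsub ((Finset.finite_toSet _).image _)
    _ ≤ (Finset.range (m + l) : Set ℕ).ncard := Set.ncard_image_le (Finset.finite_toSet _)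
    _ = m + l := by rw [Set.ncard_coe_finset, Finset.card_range]

theorem complexity_zero (w : ℕ → ℕ) : complexity w 0 = 1 := by
  rw [complexity, Set.ncard_eq_one]
  exact ⟨block w 0 0, Set.eq_singleton_iff_unique_mem.2
    ⟨block_mem_blocks w 0 0, fun _ _ => Subsingleton.elim _ _⟩⟩

/-- Morse–Hedlund: with no growth, each block of length `n` determines the next letter, and a
repeated block gives a period. -/
theorem complexity_lt_succ {N : ℕ} (hw : InAlphabet N w) (hper : ¬ EventuallyPeriodic w) (n : ℕ) :
    complexity w n < complexity w (n + 1) := by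
  by_contra hle
  rw [not_lt] at hle
  have hinj : Set.InjOn (Fin.init : (Fin (n + 1) → ℕ) → Fin n → ℕ) (blocks w (n + 1)) := by
    refine Set.injOn_of_ncard_image_eq (le_antisymm
      (Set.ncard_image_le (hw.finite_blocks _)) ?_) (hw.finite_blocks _)
    rw [image_init_blocks]
    exact hle
  obtain ⟨i, -, j, -, hij, he⟩ := Set.infinite_univ.exists_lt_map_eq_of_mapsTo
    (fun i _ => block_mem_blocks w n i) (hw.finite_blocks n)
  have key : ∀ k, block w (n + 1) (i + k) = block w (n + 1) (j + k) := by
    intro k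
    have hstep : ∀ p q, block w n p = block w n q → block w (n + 1) p = block w (n + 1) q :=
      fun p q h => hinj (block_mem_blocks _ _ _) (block_mem_blocks _ _ _) h
    induction k with
    | zero => exact hstep _ _ he
    | succ k ih =>
      refine hstep _ _ (block_eq_iff.2 fun q hq => ?_)
      have := block_eq_iff.1 ih (q + 1) (by omega)
      rwa [show i + k + (q + 1) = i + (k + 1) + q by ring,
        show j + k + (q + 1) = j + (k + 1) + q by ring] at this
  refine hper ⟨i, j - i, by omega, fun k hk => ?_⟩
  have := block_eq_iff.1 (key (k - i)) 0 (by omega)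
  rw [show i + (k - i) + 0 = k by omega, show j + (k - i) + 0 = k + (j - i) by omega] at this
  exact this.symm

/-- A map of a finite set onto a set with one element less identifies exactly one pair. -/
theorem exists_pair_of_ncard_eq_image_succ {α β : Type*} {f : α → β} {S : Set α} (hS : S.Finite)
    (h : S.ncard = (f '' S).ncard + 1) :
    ∃ x ∈ S, ∃ y ∈ S, x ≠ y ∧ f x = f y ∧ ∀ u ∈ S, ∀ v ∈ S, u ≠ v → f u = f v →
      (u = x ∧ v = y) ∨ (u = y ∧ v = x) := by
  obtain ⟨x, hx, y, hy, hne, hf⟩ : ∃ x ∈ S, ∃ y ∈ S, x ≠ y ∧ f x = f y := by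
    by_contra hcon
    push Not at hcon
    have : Set.InjOn f S := fun x hx y hy hf => by
      by_contra hne
      exact hcon x hx y hy hne hf
    rw [this.ncard_image] at h
    omega
  have key : ∀ x ∈ S, ∀ y ∈ S, x ≠ y → f x = f y → Set.InjOn f (S \ {x}) := by
    intro x hx y hy hne hf
    have himg : f '' (S \ {x}) = f '' S := by
      refine (Set.image_mono Set.sdiff_subset).antisymm ?_
      rintro _ ⟨u, hu, rfl⟩
      by_cases hux : u = x
      · exact ⟨y, ⟨hy, hne.symm⟩, by rw [hux, hf]⟩
      · exact ⟨u, ⟨hu, hux⟩, rfl⟩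
    refine Set.injOn_of_ncard_image_eq ?_ (hS.subset Set.sdiff_subset)
    rw [himg]
    have := Set.ncard_sdiff_singleton_add_one hx hS
    omega
  have h1 := key x hx y hy hne hf
  have h2 := key y hy x hx hne.symm hf.symm
  refine ⟨x, hx, y, hy, hne, hf, fun u hu v hv huv he => ?_⟩
  have h1' : u = x ∨ v = x := by
    by_contra hcon
    push Not at hcon
    exact huv (h1 ⟨hu, hcon.1⟩ ⟨hv, hcon.2⟩ he)
  have h2' : u = y ∨ v = y := by
    by_contra hcon
    push Not at hcon
    exact huv (h2 ⟨hu, hcon.1⟩ ⟨hv, hcon.2⟩ he)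
  rcases h1' with h | h <;> rcases h2' with h' | h'
  · exact absurd (h.symm.trans h') hne
  · exact Or.inl ⟨h, h'⟩
  · exact Or.inr ⟨h', h⟩
  · exact absurd (h.symm.trans h') hne

theorem pastEq_iff_block_eq {s t : ℕ} (hs : n ≤ s) (ht : n ≤ t) :
    PastEq w n s t ↔ block w n (s - n) = block w n (t - n) := by
  rw [block_eq_iff]
  constructor
  · rintro ⟨-, -, h⟩ k hk
    have := h (n - (k + 1)) (by omega)
    rwa [show s - (n - (k + 1) + 1) = s - n + k by omega,
      show t - (n - (k + 1) + 1) = t - n + k by omega] at this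
  · refine fun h => ⟨hs, ht, fun k hk => ?_⟩
    have := h (n - (k + 1)) (by omega)
    rwa [show s - n + (n - (k + 1)) = s - (k + 1) by omega,
      show t - n + (n - (k + 1)) = t - (k + 1) by omega] at this

theorem exists_letters_of_complexity_succ {N : ℕ} (hw : InAlphabet N w)
    (h : complexity w (n + 1) = complexity w n + 1) :
    ∃ a b, a ≠ b ∧ (∀ s ∈ special w n, ∀ t ∈ special w n, PastEq w n s t) ∧
      (∀ t ∈ special w n, w t = a ∨ w t = b) ∧ (special w n).Nonempty := by
  have himg := image_init_blocks w n
  obtain ⟨x, ⟨i, hi⟩, y, ⟨j, hj⟩, hne, hxy, hall⟩ :=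
    exists_pair_of_ncard_eq_image_succ (f := (Fin.init : (Fin (n + 1) → ℕ) → Fin n → ℕ))
      (hw.finite_blocks (n + 1)) (by rw [himg]; exact h)
  change block w (n + 1) i = x at hi
  change block w (n + 1) j = y at hj
  have hblock : block w n i = block w n j := by
    rw [← init_block w n i, ← init_block w n j, hi, hj, hxy]
  have hlast : ∀ p q, block w n p = block w n q → w (p + n) = w (q + n) →
      block w (n + 1) p = block w (n + 1) q := by
    refine fun p q h1 h2 => block_eq_iff.2 fun k hk => ?_
    rcases Nat.lt_succ_iff_lt_or_eq.1 hk with hk | rfl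
    · exact block_eq_iff.1 h1 k hk
    · exact h2
  have hmem : ∀ t ∈ special w n,
      block w (n + 1) (t - n) = x ∨ block w (n + 1) (t - n) = y := by
    rintro t ⟨s, hs, hst⟩
    have hb := (pastEq_iff_block_eq hs.1 hs.2.1).1 hs
    have hneb : block w (n + 1) (s - n) ≠ block w (n + 1) (t - n) := by
      intro he
      have := block_eq_iff.1 he n (by omega)
      rw [Nat.sub_add_cancel hs.1, Nat.sub_add_cancel hs.2.1] at this
      exact hst this
    rcases hall _ (block_mem_blocks w (n + 1) (s - n)) _ (block_mem_blocks w (n + 1) (t - n))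
      hneb hb with h | h
    · exact Or.inr h.2
    · exact Or.inl h.2
  have hinit : ∀ t ∈ special w n, block w n (t - n) = block w n i := by
    intro t ht
    rcases hmem t ht with h | h
    · rw [← init_block w n (t - n), h, ← hi, init_block]
    · rw [← init_block w n (t - n), h, ← hj, init_block, hblock]
  have hab : w (i + n) ≠ w (j + n) := by
    intro hlet
    exact hne (hi.symm.trans ((hlast i j hblock hlet).trans hj))
  refine ⟨w (i + n), w (j + n), hab, fun s hs t ht => ?_, fun t ht => ?_, i + n, j + n, ?_,
    hab.symm⟩
  · exact (pastEq_iff_block_eq (le_of_mem_special hs) (le_of_mem_special ht)).2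
      ((hinit s hs).trans (hinit t ht).symm)
  · have hnt := le_of_mem_special ht
    refine (hmem t ht).imp (fun h => ?_) fun h => ?_
    · have := block_eq_iff.1 (h.trans hi.symm) n (by omega)
      rwa [Nat.sub_add_cancel hnt] at this
    · have := block_eq_iff.1 (h.trans hj.symm) n (by omega)
      rwa [Nat.sub_add_cancel hnt] at this
  · rw [pastEq_iff_block_eq (by omega) (by omega)]
    simpa using hblock.symm

theorem exists_complexity_eq_add {N B : ℕ} (hw : InAlphabet N w) (hper : ¬ EventuallyPeriodic w)
    (hB : ∀ n, complexity w n ≤ n + B) : ∃ D n₀, ∀ n ≥ n₀, complexity w n = n + D := by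
  have hlt := complexity_lt_succ hw hper
  have hge : ∀ n, n ≤ complexity w n := by
    intro n
    induction n with
    | zero => omega
    | succ n ih => have := hlt n; omega
  have hmono : Monotone fun n => complexity w n - n := by
    refine monotone_nat_of_le_succ fun n => ?_
    have := hlt n
    omega
  have hbdd : BddAbove (Set.range fun n => complexity w n - n) := by
    refine ⟨B, ?_⟩
    rintro _ ⟨n, rfl⟩
    have := hB n
    change complexity w n - n ≤ B
    omega
  obtain ⟨n₀, h₀⟩ := Nat.sSup_mem (Set.range_nonempty _) hbdd
  refine ⟨sSup (Set.range fun n => complexity w n - n), n₀, fun n hn => ?_⟩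
  have h1 : complexity w n₀ - n₀ ≤ complexity w n - n := hmono hn
  have h2 : complexity w n - n ≤ sSup (Set.range fun n => complexity w n - n) :=
    le_csSup hbdd ⟨n, rfl⟩
  have h3 : complexity w n₀ - n₀ = sSup (Set.range fun n => complexity w n - n) := h₀
  have := hge n
  omega

/-- Take a tail whose eventual constant `D` in complexity `n + D` is least. Later tails cannot lose
any block, which is recurrence. Complexity growing by exactly one gives a single right special block
with two continuations. -/
theorem exists_frame_tail {N B : ℕ} (hw : InAlphabet N w) (hper : ¬ EventuallyPeriodic w)
    (hB : ∀ n, complexity w n ≤ n + B) :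
    ∃ i n₀ a b, Frame (fun k => w (i + k)) n₀ a b := by
  classical
  have hmono : ∀ {i j} n, i ≤ j →
      complexity (fun k => w (j + k)) n ≤ complexity (fun k => w (i + k)) n :=
    fun n hij => Set.ncard_le_ncard (blocks_tail_subset w n hij) ((hw.tail _).finite_blocks n)
  have hw0 : (fun k => w (0 + k)) = w := by simp
  have hex : ∀ i, ∃ D n₀, ∀ n ≥ n₀, complexity (fun k => w (i + k)) n = n + D := fun i =>
    exists_complexity_eq_add (hw.tail i) (not_eventuallyPeriodic_tail hper i) fun n =>
      (hmono n (Nat.zero_le i)).trans (by rw [hw0]; exact hB n)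
  have hmin : ∃ D, ∃ i n₀, ∀ n ≥ n₀, complexity (fun k => w (i + k)) n = n + D :=
    ⟨_, 0, (hex 0).choose_spec⟩
  obtain ⟨i, n₀, hi⟩ := Nat.find_spec hmin
  set D := Nat.find hmin
  have hblocks : ∀ j ≥ i, ∀ n, blocks (fun k => w (i + k)) n ⊆ blocks (fun k => w (j + k)) n := by
    intro j hj n
    obtain ⟨D', n₁, hj'⟩ := hex j
    have hD' : D ≤ D' := Nat.find_min' hmin ⟨j, n₁, hj'⟩
    set m := max n (max n₀ n₁)
    have heq : blocks (fun k => w (j + k)) m = blocks (fun k => w (i + k)) m := by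
      refine Set.eq_of_subset_of_ncard_le (blocks_tail_subset w m hj) ?_
        ((hw.tail _).finite_blocks m)
      change complexity _ m ≤ complexity _ m
      rw [hi m (by omega), hj' m (by omega)]
      omega
    rintro _ ⟨k, rfl⟩
    obtain ⟨q, hq⟩ : block (fun k => w (i + k)) m k ∈ blocks (fun k => w (j + k)) m :=
      heq ▸ block_mem_blocks _ m k
    exact ⟨q, funext fun r => congrFun hq ⟨r, r.2.trans_le (le_max_left _ _)⟩⟩
  set u : ℕ → ℕ := fun k => w (i + k) with hu
  have huN : InAlphabet N u := hw.tail i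
  have huper : ¬ EventuallyPeriodic u := not_eventuallyPeriodic_tail hper i
  have hlet : ∀ n ≥ n₀, ∃ a b, a ≠ b ∧ (∀ s ∈ special u n, ∀ t ∈ special u n, PastEq u n s t) ∧
      (∀ t ∈ special u n, u t = a ∨ u t = b) ∧ (special u n).Nonempty := fun n hn =>
    exists_letters_of_complexity_succ huN (by rw [hi n hn, hi (n + 1) (by omega)]; ring)
  -- The letters found at level `n₀` serve at all higher levels, since special positions there are
  -- also special at level `n₀`.
  obtain ⟨a, b, hab, -, h2, -⟩ := hlet n₀ le_rfl
  refine ⟨i, n₀, a, b, fun p n M => ?_, ?_, hab, fun n hn => ?_, fun n hn t ht => ?_,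
    fun n hn => ?_⟩
  · obtain ⟨q, hq⟩ := hblocks (i + M) (by omega) n ⟨p, rfl⟩
    refine ⟨M + q, by omega, fun k hk => ?_⟩
    have := congrFun hq ⟨k, hk⟩
    change w (i + M + (q + k)) = w (i + (p + k)) at this
    rw [← this]
    change w _ = w _
    congr 1
    ring
  · rintro ⟨d, hd, h⟩
    exact huper ⟨0, d, hd, fun i _ => h i⟩
  · obtain ⟨_, _, _, h, -⟩ := hlet n hn
    exact h
  · exact h2 t (special_anti hn ht)
  · obtain ⟨_, _, _, -, -, h⟩ := hlet n hn
    exact h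

end
/-! ### Powers of matrices congruent to the identity -/

section
open Polynomial

/-- Each `p`-th power gains one factor `p` in the linear term. Starting from `p ^ 2` makes the
quadratic error negligible for every `p`, including 2, with no information on binomial coefficients.
-/
theorem exists_one_add_sq_mul_pow {R : Type*} [CommRing R] (p : ℕ) (x : R) (i l : ℕ) :
    ∃ g, (1 + (p : R) ^ 2 * x) ^ (p ^ i * l) = 1 + (p : R) ^ (i + 2) * (l * x + p * g) := by
  have h : ∃ g, (1 + (p : R) ^ 2 * x) ^ p ^ i = 1 + (p : R) ^ (i + 2) * (x + p * g) := by
    induction i with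
    | zero => exact ⟨0, by simp⟩
    | succ i ih =>
      obtain ⟨g, hg⟩ := ih
      obtain ⟨k, hk⟩ := powAddExpansion (1 : R) ((p : R) ^ (i + 2) * (x + p * g)) p
      refine ⟨g + k * (p : R) ^ i * (x + p * g) ^ 2, ?_⟩
      rw [pow_succ (p : ℕ) i, pow_mul, hg, hk]
      ring
  obtain ⟨g, hg⟩ := h
  obtain ⟨k, hk⟩ := powAddExpansion (1 : R) ((p : R) ^ (i + 2) * (x + p * g)) l
  refine ⟨l * g + k * (p : R) ^ (i + 1) * (x + p * g) ^ 2, ?_⟩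
  rw [pow_mul, hg, hk]
  ring

variable {p : ℕ} [Fact p.Prime]

theorem exists_natCast_mul_add_dvd {η : ℤ_[p]} (hη : ¬ (p : ℤ_[p]) ∣ η) (q : ℤ_[p]) :
    ∃ l : ℕ, (p : ℤ_[p]) ∣ q + l * η := by
  have hunit : IsUnit η := by
    rw [PadicInt.isUnit_iff]
    refine (PadicInt.norm_le_one η).antisymm (not_lt.1 fun h => hη ?_)
    exact PadicInt.norm_lt_one_iff_dvd η |>.1 h
  obtain ⟨η', hη'⟩ := hunit.exists_left_inv
  have h := PadicInt.appr_spec 1 (-q * η')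
  rw [pow_one, Ideal.mem_span_singleton] at h
  obtain ⟨z, hz⟩ := h
  refine ⟨(-q * η').appr 1, -z * η, ?_⟩
  linear_combination (-η) * hz - q * hη'

/-- A successive approximation for the zeros of `n ↦ Λ ((1 + p² X) ^ n)`. -/
theorem exists_pow_dvd_apply_pow {Λ : ℤ[X] →+ ℤ_[p]} {c : ℕ}
    (hΛ : ∀ g h : ℤ[X], ∃ u v : ℤ_[p], Λ (g * h) = u * Λ h + v * Λ (X * h))
    (h₀ : (p : ℤ_[p]) ^ (c + 2) ∣ Λ 1)
    (h₁ : ∃ η, Λ X = (p : ℤ_[p]) ^ c * η ∧ ¬ (p : ℤ_[p]) ∣ η) (i : ℕ) :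
    ∃ n, (p : ℤ_[p]) ^ (c + 2 + i) ∣ Λ ((1 + (p : ℤ[X]) ^ 2 * X) ^ n) ∧
      ∃ η, Λ (X * (1 + (p : ℤ[X]) ^ 2 * X) ^ n) = (p : ℤ_[p]) ^ c * η ∧ ¬ (p : ℤ_[p]) ∣ η := by
  induction i with
  | zero => exact ⟨0, by simpa using h₀, by simpa using h₁⟩
  | succ i ih =>
    obtain ⟨n, ⟨q, hq⟩, η, hη, hpη⟩ := ih
    set h := (1 + (p : ℤ[X]) ^ 2 * X) ^ n
    -- Replacing `n` by `n + p ^ i * l` changes the value by `p ^ (c + 2 + i) * l * η`, up to a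
    -- multiple of `p ^ (c + 3 + i)`; `l` cancels the residue `q` modulo `p`.
    obtain ⟨l, z, hz⟩ := exists_natCast_mul_add_dvd hpη q
    obtain ⟨g, hg⟩ := exists_one_add_sq_mul_pow p (X : ℤ[X]) i l
    have hmul : ∀ (m : ℕ) (f : ℤ[X]), Λ ((m : ℤ[X]) * f) = m * Λ f := by
      intro m f
      rw [← nsmul_eq_mul, map_nsmul, nsmul_eq_mul]
    obtain ⟨u, v, huv⟩ := hΛ g h
    obtain ⟨u', v', huv'⟩ := hΛ (X * ((l : ℤ[X]) * X + (p : ℤ[X]) * g)) h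
    refine ⟨n + p ^ i * l, ?_, ?_⟩
    · have e : (1 + (p : ℤ[X]) ^ 2 * X) ^ (n + p ^ i * l) =
          h + ((p ^ (i + 2) * l : ℕ) : ℤ[X]) * (X * h) + ((p ^ (i + 3) : ℕ) : ℤ[X]) * (g * h) := by
        rw [pow_add, hg]
        push_cast
        ring
      rw [e, map_add, map_add, hmul, hmul, huv, hη, hq]
      push_cast
      refine ⟨z + u * (p : ℤ_[p]) ^ (i + 2) * q + v * η, ?_⟩
      linear_combination (p : ℤ_[p]) ^ (c + 2 + i) * hz
    · have e : X * (1 + (p : ℤ[X]) ^ 2 * X) ^ (n + p ^ i * l) =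
          X * h + ((p ^ (i + 2) : ℕ) : ℤ[X]) * (X * ((l : ℤ[X]) * X + (p : ℤ[X]) * g) * h) := by
        rw [pow_add, hg]
        push_cast
        ring
      rw [e, map_add, hmul, huv', hη, hq]
      push_cast
      refine ⟨η + p * ((p : ℤ_[p]) ^ (i + 1) * (u' * (p : ℤ_[p]) ^ (i + 2) * q + v' * η)),
        by ring, fun hdvd => hpη ?_⟩
      exact (dvd_add_left (dvd_mul_right _ _)).1 hdvd

/-- Cayley–Hamilton reduces every polynomial in `E` to degree at most one. -/
theorem exists_aeval_eq_add_smul {R : Type*} [CommRing R] (E : Matrix (Fin 2) (Fin 2) R)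
    (g : ℤ[X]) : ∃ u v : R, aeval E g = u • (1 : Matrix (Fin 2) (Fin 2) R) + v • E := by
  have hsq : E * E = E.trace • E - E.det • (1 : Matrix (Fin 2) (Fin 2) R) := by
    ext i j
    fin_cases i <;> fin_cases j <;>
      simp [Matrix.mul_apply, Fin.sum_univ_two, Matrix.trace, Matrix.det_fin_two] <;> ring
  induction g using Polynomial.induction_on' with
  | add f g hf hg =>
    obtain ⟨u, v, h⟩ := hf
    obtain ⟨u', v', h'⟩ := hg
    exact ⟨u + u', v + v', by rw [map_add, h, h']; module⟩
  | monomial n c =>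
    have hpow : ∃ u v : R, E ^ n = u • (1 : Matrix (Fin 2) (Fin 2) R) + v • E := by
      induction n with
      | zero => exact ⟨1, 0, by simp⟩
      | succ n ih =>
        obtain ⟨u, v, h⟩ := ih
        refine ⟨-(v * E.det), u + v * E.trace, ?_⟩
        rw [pow_succ, h, add_mul, smul_mul_assoc, one_mul, smul_mul_assoc, hsq]
        module
    obtain ⟨u, v, h⟩ := hpow
    refine ⟨c * u, c * v, ?_⟩
    rw [aeval_monomial, h, eq_intCast, ← zsmul_eq_mul, smul_add, ← Int.cast_smul_eq_zsmul R,
      ← Int.cast_smul_eq_zsmul R, smul_smul, smul_smul]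

theorem max_sq_pos {a b : ℤ} (hab : (a, b) ≠ (0, 0)) :
    0 < max ((a : ℝ) ^ 2) ((b : ℝ) ^ 2) := by
  by_contra hle
  rw [not_lt, max_le_iff] at hle
  refine hab (Prod.ext ?_ ?_)
  · exact_mod_cast (pow_eq_zero_iff two_ne_zero).1 (le_antisymm hle.1 (sq_nonneg _))
  · exact_mod_cast (pow_eq_zero_iff two_ne_zero).1 (le_antisymm hle.2 (sq_nonneg _))

theorem exists_lt_of_not_eigenvector {y : Fin 2 → ℤ_[p]} {E : Matrix (Fin 2) (Fin 2) ℤ_[p]}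
    (hne : y 0 * (E.mulVec y) 1 - y 1 * (E.mulVec y) 0 ≠ 0) {δ : ℝ} (hδ : 0 < δ) :
    ∃ (n : ℕ) (a b : ℤ), (a, b) ≠ (0, 0) ∧
      ‖(a : ℤ_[p]) * (((1 + (p : ℤ_[p]) ^ 2 • E) ^ n).mulVec y) 0 +
        (b : ℤ_[p]) * (((1 + (p : ℤ_[p]) ^ 2 • E) ^ n).mulVec y) 1‖ <
      δ / max ((a : ℝ) ^ 2) ((b : ℝ) ^ 2) := by
  set ω := y 0 * (E.mulVec y) 1 - y 1 * (E.mulVec y) 0 with hω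
  obtain ⟨c, η, hcη, hη⟩ : ∃ (c : ℕ) (η : ℤ_[p]), ω = (p : ℤ_[p]) ^ c * η ∧
      ¬ (p : ℤ_[p]) ∣ η := by
    have hfin : FiniteMultiplicity (p : ℤ_[p]) ω :=
      FiniteMultiplicity.of_not_isUnit (PadicInt.prime_p.not_isUnit) hne
    exact ⟨_, hfin.exists_eq_pow_mul_and_not_dvd⟩
  -- The row `(a, b)` approximates `(-y 1, y 0)`, which kills `y` and takes the value `ω` on `E y`.
  -- Precision `c + 2` keeps the valuation `c` of `ω`. The row is fixed before the target size `K`,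
  -- so the bound `δ / max` stays constant.
  obtain ⟨ra, hra⟩ := Ideal.mem_span_singleton.1 (PadicInt.appr_spec (c + 2) (-y 1))
  obtain ⟨rb, hrb⟩ := Ideal.mem_span_singleton.1 (PadicInt.appr_spec (c + 2) (y 0))
  set a : ℤ := (((-y 1).appr (c + 2) : ℕ) : ℤ)
  set b : ℤ := (((y 0).appr (c + 2) : ℕ) : ℤ)
  have ha : (a : ℤ_[p]) = -y 1 - (p : ℤ_[p]) ^ (c + 2) * ra := by
    simp only [a, Int.cast_natCast]
    linear_combination -hra
  have hb : (b : ℤ_[p]) = y 0 - (p : ℤ_[p]) ^ (c + 2) * rb := by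
    simp only [b, Int.cast_natCast]
    linear_combination -hrb
  let Λ : ℤ[X] →+ ℤ_[p] :=
    { toFun := fun g => (a : ℤ_[p]) * ((aeval E g).mulVec y) 0 + b * ((aeval E g).mulVec y) 1
      map_zero' := by simp
      map_add' := fun f g => by
        simp only [map_add, Matrix.add_mulVec, Pi.add_apply]
        ring }
  have hΛapp : ∀ g, Λ g = (a : ℤ_[p]) * ((aeval E g).mulVec y) 0 +
    b * ((aeval E g).mulVec y) 1 := fun _ => rfl
  have hΛ : ∀ g h : ℤ[X], ∃ u v : ℤ_[p], Λ (g * h) = u * Λ h + v * Λ (X * h) := by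
    intro g h
    obtain ⟨u, v, huv⟩ := exists_aeval_eq_add_smul E g
    refine ⟨u, v, ?_⟩
    simp only [hΛapp, map_mul, aeval_X, huv, add_mul, smul_mul_assoc, one_mul,
      Matrix.add_mulVec, Matrix.smul_mulVec, Pi.add_apply, Pi.smul_apply, smul_eq_mul]
    ring
  have h₀ : (p : ℤ_[p]) ^ (c + 2) ∣ Λ 1 := by
    refine ⟨-(ra * y 0 + rb * y 1), ?_⟩
    rw [hΛapp, map_one, Matrix.one_mulVec, ha, hb]
    ring
  have h₁ : ∃ η, Λ X = (p : ℤ_[p]) ^ c * η ∧ ¬ (p : ℤ_[p]) ∣ η := by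
    refine ⟨η + p * (-(p * (ra * (E.mulVec y) 0 + rb * (E.mulVec y) 1))), ?_, fun hd => hη ?_⟩
    · rw [hΛapp, aeval_X, ha, hb]
      linear_combination hcη - hω
    · exact (dvd_add_left (dvd_mul_right _ _)).1 hd
  have hab : (a, b) ≠ (0, 0) := by
    intro h
    obtain ⟨h1, h2⟩ := Prod.mk.inj h
    obtain ⟨η', h3, h4⟩ := h₁
    rw [hΛapp, h1, h2] at h3
    simp only [Int.cast_zero, zero_mul, add_zero] at h3
    rcases mul_eq_zero.1 h3.symm with h5 | h5
    · exact PadicInt.prime_p.ne_zero (eq_zero_of_pow_eq_zero h5)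
    · exact h4 (h5 ▸ dvd_zero _)
  have hpos := max_sq_pos hab
  have hp1 : (p : ℝ)⁻¹ < 1 := inv_lt_one_of_one_lt₀ (by exact_mod_cast (Fact.out : p.Prime).one_lt)
  obtain ⟨K, hK⟩ := exists_pow_lt_of_lt_one (div_pos hδ hpos) hp1
  obtain ⟨n, ⟨q, hq⟩, -⟩ := exists_pow_dvd_apply_pow hΛ h₀ h₁ K
  refine ⟨n, a, b, hab, lt_of_le_of_lt ?_ hK⟩
  have hC : aeval E ((1 + (p : ℤ[X]) ^ 2 * X) ^ n) = (1 + (p : ℤ_[p]) ^ 2 • E) ^ n := by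
    simp only [map_pow, map_add, map_one, map_mul, map_natCast, aeval_X]
    congr 2
    rw [← Nat.cast_pow, ← Nat.cast_pow, ← nsmul_eq_mul, Nat.cast_smul_eq_nsmul]
  rw [hΛapp, hC] at hq
  rw [hq, norm_mul, PadicInt.norm_p_pow, zpow_neg, zpow_natCast, inv_pow]
  calc ((p : ℝ) ^ (c + 2 + K))⁻¹ * ‖q‖ ≤ ((p : ℝ) ^ (c + 2 + K))⁻¹ * 1 := by
        gcongr
        exact PadicInt.norm_le_one q
    _ ≤ ((p : ℝ) ^ K)⁻¹ := by
        rw [mul_one]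
        have : (1 : ℝ) ≤ p := by exact_mod_cast (Fact.out : p.Prime).one_le
        have h0 : (0 : ℝ) < p := by linarith
        gcongr
        omega

end
/-! ### Products of letter matrices -/

/-- The matrix `A_a` as an element of `GL₂(ℤ)`. -/
def letterUnit (a : ℕ) : GL (Fin 2) ℤ where
  val := !![0, 1; 1, (a : ℤ)]
  inv := !![-(a : ℤ), 1; 1, 0]
  val_inv := by ext i j; fin_cases i <;> fin_cases j <;> simp
  inv_val := by ext i j; fin_cases i <;> fin_cases j <;> simp

/-- The entries are nonnegative and increase along each row. -/
def RowsIncrease (M : Matrix (Fin 2) (Fin 2) ℤ) : Prop :=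
  ∀ i, 0 ≤ M i 0 ∧ M i 0 ≤ M i 1

section
variable {S : Set ℕ}

theorem mul_letterUnit_zero (M : GL (Fin 2) ℤ) (c : ℕ) (i : Fin 2) :
    (M * letterUnit c).1 i 0 = M.1 i 1 := by
  simp [letterUnit, Matrix.mul_apply, Fin.sum_univ_two]

theorem mul_letterUnit_one (M : GL (Fin 2) ℤ) (c : ℕ) (i : Fin 2) :
    (M * letterUnit c).1 i 1 = M.1 i 0 + c * M.1 i 1 := by
  simp [letterUnit, Matrix.mul_apply, Fin.sum_univ_two, mul_comm]

theorem mul_letterUnit_rowsIncrease {M : GL (Fin 2) ℤ} (hM : ∀ i j, 0 ≤ M.1 i j) {c : ℕ}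
    (hc : 1 ≤ c) : RowsIncrease (M * letterUnit c).1 := by
  intro i
  rw [mul_letterUnit_zero, mul_letterUnit_one]
  have hc' : (1 : ℤ) ≤ c := by exact_mod_cast hc
  refine ⟨hM i 1, ?_⟩
  nlinarith [hM i 0, hM i 1]

theorem nonneg_of_mem_closure {x : GL (Fin 2) ℤ}
    (hx : x ∈ Submonoid.closure (letterUnit '' S)) : ∀ i j, 0 ≤ x.1 i j := by
  induction hx using Submonoid.closure_induction with
  | mem x hx =>
    obtain ⟨c, -, rfl⟩ := hx
    intro i j
    fin_cases i <;> fin_cases j <;> simp [letterUnit]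
  | one =>
    intro i j
    fin_cases i <;> fin_cases j <;> simp
  | mul x y _ _ hx hy =>
    intro i j
    rw [Units.val_mul, Matrix.mul_apply]
    exact Finset.sum_nonneg fun k _ => mul_nonneg (hx i k) (hy k j)

theorem RowsIncrease.mul_mem_closure (hS : ∀ c ∈ S, 1 ≤ c) {x : GL (Fin 2) ℤ}
    (hx : x ∈ Submonoid.closure (letterUnit '' S)) :
    ∀ {M : GL (Fin 2) ℤ}, RowsIncrease M.1 → RowsIncrease (M * x).1 := by
  induction hx using Submonoid.closure_induction with
  | mem x hx =>
    obtain ⟨c, hc, rfl⟩ := hx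
    intro M hM
    refine mul_letterUnit_rowsIncrease (fun i j => ?_) (hS c hc)
    fin_cases j
    · exact (hM i).1
    · exact (hM i).1.trans (hM i).2
  | one => intro M hM; rwa [mul_one]
  | mul x y _ _ hx hy =>
    intro M hM
    rw [← mul_assoc]
    exact hy (hx hM)

/-- Both second columns equal some v, and the first columns differ by (b - a)v. If a < b, the bound
of the first column of `M` by v forces that of `M'` to vanish, against invertibility. -/
theorem not_lt_of_mul_letterUnit_eq {M M' : GL (Fin 2) ℤ} (hM : RowsIncrease M.1)
    (hM' : RowsIncrease M'.1) {a b : ℕ} (h : M * letterUnit a = M' * letterUnit b) : ¬ a < b := by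
  intro hab
  have hab' : (a : ℤ) + 1 ≤ b := by exact_mod_cast hab
  have hz : ∀ i, M'.1 i 0 = 0 := by
    intro i
    have h0 := mul_letterUnit_zero M a i
    have h1 := mul_letterUnit_one M a i
    rw [h, mul_letterUnit_zero] at h0
    rw [h, mul_letterUnit_one, ← h0] at h1
    have h2 := hM i
    have h3 := hM' i
    rw [← h0] at h2
    nlinarith
  have hdet : IsUnit M'.1.det := (Matrix.isUnit_iff_isUnit_det _).1 M'.isUnit
  rw [Matrix.det_fin_two, hz 0, hz 1] at hdet
  simp at hdet

theorem letter_eq_of_commute (hS : ∀ c ∈ S, 1 ≤ c) {a b : ℕ} (ha : a ∈ S) (hb : b ∈ S)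
    {x y : GL (Fin 2) ℤ} (hx : x ∈ Submonoid.closure (letterUnit '' S))
    (hy : y ∈ Submonoid.closure (letterUnit '' S)) (k : ℕ)
    (h : Commute ((x * letterUnit a) ^ (k + 1)) ((y * letterUnit b) ^ (k + 1))) : a = b := by
  -- With the last letter of the product stripped, a factor `letterUnit c` remains inside, and it
  -- makes the rows increase.
  have key : ∀ {c d : ℕ}, c ∈ S → d ∈ S → ∀ {u v : GL (Fin 2) ℤ},
      u ∈ Submonoid.closure (letterUnit '' S) → v ∈ Submonoid.closure (letterUnit '' S) →
      RowsIncrease ((u * letterUnit c) ^ (k + 1) * ((v * letterUnit d) ^ k * v)).1 := by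
    intro c d hc hd u v hu hv
    have hgen : ∀ e ∈ S, letterUnit e ∈ Submonoid.closure (letterUnit '' S) :=
      fun e he => Submonoid.subset_closure ⟨e, he, rfl⟩
    refine RowsIncrease.mul_mem_closure hS
      (mul_mem (pow_mem (mul_mem hv (hgen d hd)) k) hv) ?_
    rw [pow_succ, ← mul_assoc]
    exact mul_letterUnit_rowsIncrease
      (nonneg_of_mem_closure (mul_mem (pow_mem (mul_mem hu (hgen c hc)) k) hu)) (hS c hc)
  have he : (x * letterUnit a) ^ (k + 1) * ((y * letterUnit b) ^ k * y) * letterUnit b =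
      (y * letterUnit b) ^ (k + 1) * ((x * letterUnit a) ^ k * x) * letterUnit a := by
    calc _ = (x * letterUnit a) ^ (k + 1) * (y * letterUnit b) ^ (k + 1) := by
          rw [pow_succ (y * letterUnit b) k]
          simp only [mul_assoc]
      _ = (y * letterUnit b) ^ (k + 1) * (x * letterUnit a) ^ (k + 1) := h.eq
      _ = _ := by
          rw [pow_succ (x * letterUnit a) k]
          simp only [mul_assoc]
  have h1 := not_lt_of_mul_letterUnit_eq (key ha hb hx hy) (key hb ha hy hx) he
  have h2 := not_lt_of_mul_letterUnit_eq (key hb ha hy hx) (key ha hb hx hy) he.symm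
  omega

end

/-! ### Integer matrices acting on `p`-adic vectors -/

/-- The action of integer matrices on vectors over a ring. -/
def intMulVec {R : Type*} [CommRing R] (g : GL (Fin 2) ℤ) (y : Fin 2 → R) : Fin 2 → R :=
  ((Int.castRingHom R).mapMatrix g.1).mulVec y

section
variable {R : Type*} [CommRing R]

theorem intMulVec_one (y : Fin 2 → R) : intMulVec 1 y = y := by
  simp [intMulVec]

theorem intMulVec_mul (g h : GL (Fin 2) ℤ) (y : Fin 2 → R) :
    intMulVec (g * h) y = intMulVec g (intMulVec h y) := by
  simp only [intMulVec, Units.val_mul, map_mul, Matrix.mulVec_mulVec]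

theorem intMulVec_apply (g : GL (Fin 2) ℤ) (y : Fin 2 → R) (i : Fin 2) :
    intMulVec g y i = (g.1 i 0 : R) * y 0 + (g.1 i 1 : R) * y 1 := by
  simp [intMulVec, Matrix.mulVec, dotProduct, Fin.sum_univ_two]

end

section
variable {p : ℕ} [Fact p.Prime]

/-- `y` and all its translates by elements of `H` have no small values on integer vectors. -/
def BadOn (H : Set (GL (Fin 2) ℤ)) (δ : ℝ) (y : Fin 2 → ℤ_[p]) : Prop :=
  ∀ h ∈ H, ∀ a b : ℤ, (a, b) ≠ (0, 0) → δ / max ((a : ℝ) ^ 2) ((b : ℝ) ^ 2) ≤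
    ‖(a : ℤ_[p]) * intMulVec h y 0 + (b : ℤ_[p]) * intMulVec h y 1‖

theorem eq_add_pow_smul_of_map_eq {m : ℕ} {g h : GL (Fin 2) ℤ}
    (hgh : Matrix.GeneralLinearGroup.map (Int.castRingHom (ZMod m)) g =
      Matrix.GeneralLinearGroup.map (Int.castRingHom (ZMod m)) h) :
    ∃ E : Matrix (Fin 2) (Fin 2) ℤ, g.1 = h.1 + (m : ℤ) • E := by
  have hdvd : ∀ i j, (m : ℤ) ∣ g.1 i j - h.1 i j := by
    intro i j
    have := congrArg (fun x : GL (Fin 2) (ZMod m) => x.1 i j) hgh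
    simp only [Matrix.GeneralLinearGroup.map_apply, eq_intCast] at this
    exact (ZMod.intCast_eq_intCast_iff_dvd_sub _ _ _).1 this.symm
  choose E hE using hdvd
  refine ⟨Matrix.of E, ?_⟩
  ext i j
  have := hE i j
  simp only [Matrix.add_apply, Matrix.smul_apply, Matrix.of_apply, smul_eq_mul]
  linarith

theorem not_badOn_of_not_eigenvector {H : Subgroup (GL (Fin 2) ℤ)} {δ : ℝ} (hδ : 0 < δ)
    {y : Fin 2 → ℤ_[p]} {g : GL (Fin 2) ℤ} (hg : g ∈ H)
    (hmap : Matrix.GeneralLinearGroup.map (Int.castRingHom (ZMod (p ^ 2))) g = 1)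
    (hne : y 0 * intMulVec g y 1 - y 1 * intMulVec g y 0 ≠ 0) : ¬ BadOn (H : Set _) δ y := by
  intro hbad
  rw [← map_one (Matrix.GeneralLinearGroup.map (Int.castRingHom (ZMod (p ^ 2))))] at hmap
  obtain ⟨E, hE⟩ := eq_add_pow_smul_of_map_eq hmap
  set E' := (Int.castRingHom ℤ_[p]).mapMatrix E with hE'
  have hgE : (Int.castRingHom ℤ_[p]).mapMatrix g.1 = 1 + (p : ℤ_[p]) ^ 2 • E' := by
    rw [hE, map_add, Units.val_one, map_one, hE']
    congr 1
    ext i j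
    simp only [RingHom.mapMatrix_apply, Matrix.map_apply, Matrix.smul_apply, smul_eq_mul, map_mul]
    push_cast
    simp
  have hne' : y 0 * (E'.mulVec y) 1 - y 1 * (E'.mulVec y) 0 ≠ 0 := by
    intro h0
    refine hne ?_
    simp only [intMulVec, hgE, Matrix.add_mulVec, Matrix.one_mulVec, Matrix.smul_mulVec,
      Pi.add_apply, Pi.smul_apply, smul_eq_mul]
    linear_combination (p : ℤ_[p]) ^ 2 * h0
  obtain ⟨n, a, b, hab, hlt⟩ := exists_lt_of_not_eigenvector hne' hδ
  refine absurd (hbad (g ^ n) (pow_mem hg n) a b hab) (not_le.2 ?_)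
  simpa only [intMulVec, Units.val_pow_eq_pow_val, map_pow, hgE] using hlt

/-- Badness at the identity shows that no nonzero integer row kills `y`. On the common eigenvector
`y` the two products agree, hence so do their integer rows. -/
theorem commute_of_badOn {H : Subgroup (GL (Fin 2) ℤ)} {δ : ℝ} (hδ : 0 < δ)
    {y : Fin 2 → ℤ_[p]} (hbad : BadOn (H : Set _) δ y) {g h : GL (Fin 2) ℤ}
    (hg : y 0 * intMulVec g y 1 - y 1 * intMulVec g y 0 = 0)
    (hh : y 0 * intMulVec h y 1 - y 1 * intMulVec h y 0 = 0) : Commute g h := by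
  have hrow : ∀ a b : ℤ, (a : ℤ_[p]) * y 0 + b * y 1 = 0 → a = 0 ∧ b = 0 := by
    intro a b h0
    by_contra hcon
    have hab : (a, b) ≠ (0, 0) := fun h => hcon (Prod.mk.inj h)
    have := hbad 1 (one_mem H) a b hab
    rw [intMulVec_one, h0, norm_zero] at this
    exact absurd this (not_le.2 (div_pos hδ (max_sq_pos hab)))
  have hy0 : y 0 ≠ 0 := fun h0 => by
    have := (hrow 1 0 (by simp [h0])).1
    omega
  have heig : ∀ x : GL (Fin 2) ℤ, y 0 * intMulVec x y 1 - y 1 * intMulVec x y 0 = 0 →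
      ∀ i, y 0 * intMulVec x y i = intMulVec x y 0 * y i := by
    intro x hx i
    fin_cases i
    · exact mul_comm _ _
    · change y 0 * intMulVec x y 1 = intMulVec x y 0 * y 1
      linear_combination hx
  have htwo : ∀ u v : GL (Fin 2) ℤ, y 0 * intMulVec u y 1 - y 1 * intMulVec u y 0 = 0 →
      y 0 * intMulVec v y 1 - y 1 * intMulVec v y 0 = 0 → ∀ i,
      y 0 * y 0 * intMulVec (u * v) y i = intMulVec u y 0 * intMulVec v y 0 * y i := by
    intro u v hu hv i
    have h0 := heig v hv 0
    have h1 := heig v hv 1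
    have h2 := heig u hu i
    rw [intMulVec_mul, intMulVec_apply u (intMulVec v y)]
    rw [intMulVec_apply u y i] at h2
    linear_combination y 0 * (u.1 i 0 : ℤ_[p]) * h0 + y 0 * (u.1 i 1 : ℤ_[p]) * h1 +
      intMulVec v y 0 * h2
  have heq : ∀ i, intMulVec (g * h) y i = intMulVec (h * g) y i := by
    intro i
    refine mul_left_cancel₀ (mul_ne_zero hy0 hy0) ?_
    rw [htwo g h hg hh, htwo h g hh hg]
    ring
  refine Units.ext ?_
  ext i j
  have := heq i
  rw [intMulVec_apply, intMulVec_apply] at this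
  obtain ⟨h1, h2⟩ := hrow ((g * h).1 i 0 - (h * g).1 i 0) ((g * h).1 i 1 - (h * g).1 i 1) (by
    push_cast
    linear_combination this)
  fin_cases j
  · exact sub_eq_zero.1 h1
  · exact sub_eq_zero.1 h2

/-! ### The orbit of a point of **LMad** -/

theorem letterMatrix_eq (p : ℕ) [Fact p.Prime] (a : ℕ) :
    letterMatrix p a = (Int.castRingHom ℚ_[p]).mapMatrix (letterUnit a).1 := by
  ext i j
  fin_cases i <;> fin_cases j <;> simp [letterMatrix, letterUnit]

theorem intMulVec_ne_zero {K : Type*} [Field K] (g : GL (Fin 2) ℤ) {v : Fin 2 → K} (hv : v ≠ 0) :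
    intMulVec g v ≠ 0 := by
  intro h
  refine hv ?_
  rw [← intMulVec_one v, ← inv_mul_cancel g, intMulVec_mul, h]
  simp [intMulVec]

theorem shift_iterate (w : ℕ → ℕ) {v : Fin 2 → ℚ_[p]} (hv : v ≠ 0) (t : ℕ) :
    (shift p)^[t] (w, Projectivization.mk ℚ_[p] v hv) =
      (fun i => w (t + i), Projectivization.mk ℚ_[p] (intMulVec (cocycle letterUnit w t) v)
        (intMulVec_ne_zero _ hv)) := by
  induction t with
  | zero => simp [cocycle, intMulVec_one]
  | succ t ih =>
    rw [Function.iterate_succ_apply', ih, shift]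
    refine Prod.ext (funext fun i => ?_) ?_
    · change w (t + (i + 1)) = w (t + 1 + i)
      congr 1
      ring
    · simp only [letterAct, Projectivization.map_mk]
      congr 1
      rw [cocycle, intMulVec_mul, Matrix.toLin'_apply, letterMatrix_eq]
      rfl

theorem mem_LMad_tail {w : ℕ → ℕ} {x : P1 p} (h : (w, x) ∈ LMad p) (i : ℕ) :
    ∃ x' : P1 p, ((fun k => w (i + k)), x') ∈ LMad p := by
  induction x using Projectivization.ind with
  | h v hv =>
    obtain ⟨ε, hε, hx⟩ := h
    have hi := shift_iterate w hv i
    refine ⟨Projectivization.mk ℚ_[p] (intMulVec (cocycle letterUnit w i) v)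
      (intMulVec_ne_zero _ hv), ε, hε, fun n => ?_⟩
    rw [← hi, ← Function.iterate_add_apply]
    exact hx (n + i)

theorem exists_integral_representative {v : Fin 2 → ℚ_[p]} (hv : v ≠ 0) :
    ∃ (c : ℚ_[p]) (y : Fin 2 → ℤ_[p]), c ≠ 0 ∧ (∃ i, ‖y i‖ = 1) ∧
      c • v = fun i => (y i : ℚ_[p]) := by
  obtain ⟨i, hi⟩ := Finite.exists_max fun i => ‖v i‖
  have hvi : v i ≠ 0 := fun h0 => hv (funext fun j => by
    have := hi j
    rw [h0, norm_zero] at this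
    exact norm_le_zero_iff.1 this)
  have hle : ∀ j, ‖(v i)⁻¹ * v j‖ ≤ 1 := fun j => by
    rw [norm_mul, norm_inv, inv_mul_le_iff₀ (norm_pos_iff.2 hvi), mul_one]
    exact hi j
  let y : Fin 2 → ℤ_[p] := fun j => ⟨(v i)⁻¹ * v j, hle j⟩
  have hyi : y i = 1 := PadicInt.ext (inv_mul_cancel₀ hvi)
  exact ⟨(v i)⁻¹, y, inv_ne_zero hvi, ⟨i, by rw [hyi, norm_one]⟩, rfl⟩

theorem intMulVec_coe (g : GL (Fin 2) ℤ) (y : Fin 2 → ℤ_[p]) :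
    intMulVec g (fun i => (y i : ℚ_[p])) = fun i => ((intMulVec g y i : ℤ_[p]) : ℚ_[p]) := by
  funext i
  rw [intMulVec_apply, intMulVec_apply]
  push_cast
  rfl

theorem norm_intMulVec_le (g : GL (Fin 2) ℤ) (y : Fin 2 → ℤ_[p]) (i : Fin 2) :
    ‖intMulVec g y i‖ ≤ max ‖y 0‖ ‖y 1‖ := by
  rw [intMulVec_apply]
  refine (PadicInt.nonarchimedean _ _).trans (max_le_max ?_ ?_) <;>
  · rw [norm_mul]
    exact mul_le_of_le_one_left (norm_nonneg _) (PadicInt.norm_le_one _)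

/-- GL₂(ℤ) preserves the maximum norm, so along the orbit of a primitive vector the denominators in
`PBadVec` are all 1. -/
theorem exists_badOn_of_mem_LMad {w : ℕ → ℕ} {x : P1 p} (h : (w, x) ∈ LMad p) :
    ∃ (y : Fin 2 → ℤ_[p]) (δ : ℝ), 0 < δ ∧ BadOn (Set.range (cocycle letterUnit w)) δ y := by
  induction x using Projectivization.ind with
  | h v hv =>
    obtain ⟨ε, hε, hx⟩ := h
    obtain ⟨c, y, hc, ⟨i, hi⟩, hcy⟩ := exists_integral_representative hv
    refine ⟨y, ε, hε, ?_⟩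
    rintro _ ⟨t, rfl⟩ a b hab
    set g := cocycle letterUnit w t with hg
    have h1 := (hx t).2
    rw [shift_iterate, mk_mem_PBad, ← PBadVec_smul p ε c hc] at h1
    have h2 : c • intMulVec g v = fun i => ((intMulVec g y i : ℤ_[p]) : ℚ_[p]) := by
      rw [← intMulVec_coe, ← hcy, intMulVec, intMulVec, Matrix.mulVec_smul]
    rw [← hg, h2] at h1
    have h3 := h1 a b hab
    have h4 : ‖(a : ℚ_[p]) * ((intMulVec g y 0 : ℤ_[p]) : ℚ_[p]) +
        (b : ℚ_[p]) * ((intMulVec g y 1 : ℤ_[p]) : ℚ_[p])‖ =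
        ‖(a : ℤ_[p]) * intMulVec g y 0 + (b : ℤ_[p]) * intMulVec g y 1‖ := by
      rw [PadicInt.norm_def]
      push_cast
      rfl
    rw [h4] at h3
    have h5 : max ‖((intMulVec g y 0 : ℤ_[p]) : ℚ_[p])‖ ‖((intMulVec g y 1 : ℤ_[p]) : ℚ_[p])‖
        = 1 := by
      rw [← PadicInt.norm_def, ← PadicInt.norm_def]
      refine le_antisymm (max_le (PadicInt.norm_le_one _) (PadicInt.norm_le_one _)) ?_
      have := norm_intMulVec_le g⁻¹ (intMulVec g y) i
      rwa [← intMulVec_mul, inv_mul_cancel, intMulVec_one, hi] at this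
    rwa [h5, div_one] at h3

/-- `z` is a limit of the vectors `s k • y`. As `s k` serves all `h` at once, `h z` is a limit of
vectors `g y` with `g ∈ S`, and the lower bounds pass to the limit. -/
theorem exists_badOn_of_forall_congr {S : Set (GL (Fin 2) ℤ)} {H : Set (GL (Fin 2) ℤ)}
    {y : Fin 2 → ℤ_[p]} {δ : ℝ} (hbad : BadOn S δ y)
    (hcongr : ∀ k : ℕ, ∃ s : GL (Fin 2) ℤ, ∀ h ∈ H, ∃ g ∈ S,
      Matrix.GeneralLinearGroup.map (Int.castRingHom (ZMod (p ^ k))) g =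
        Matrix.GeneralLinearGroup.map (Int.castRingHom (ZMod (p ^ k))) (h * s)) :
    ∃ z : Fin 2 → ℤ_[p], BadOn H δ z := by
  choose s hs using hcongr
  obtain ⟨z, -, ψ, hψ, hz⟩ := isCompact_univ.tendsto_subseq
    (x := fun k => intMulVec (s k) y) fun _ => Set.mem_univ _
  refine ⟨z, fun h hh a b hab => ?_⟩
  have hcont : Continuous fun z : Fin 2 → ℤ_[p] =>
      ‖(a : ℤ_[p]) * intMulVec h z 0 + (b : ℤ_[p]) * intMulVec h z 1‖ := by
    simp only [intMulVec_apply]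
    fun_prop
  have hlim := (hcont.tendsto z).comp hz
  have hp1 : (p : ℝ)⁻¹ < 1 := inv_lt_one_of_one_lt₀ (by exact_mod_cast (Fact.out : p.Prime).one_lt)
  have hpow := (tendsto_pow_atTop_nhds_zero_of_lt_one (by positivity) hp1).comp hψ.tendsto_atTop
  have hsum := hlim.add hpow
  rw [add_zero] at hsum
  refine ge_of_tendsto' hsum fun k => ?_
  obtain ⟨g, hg, hgh⟩ := hs (ψ k) h hh
  obtain ⟨E, hE⟩ := eq_add_pow_smul_of_map_eq hgh
  refine (hbad g hg a b hab).trans ?_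
  have hvec : ∀ i, intMulVec g y i = intMulVec h (intMulVec (s (ψ k)) y) i +
      (p : ℤ_[p]) ^ ψ k * ((E i 0 : ℤ_[p]) * y 0 + (E i 1 : ℤ_[p]) * y 1) := by
    intro i
    rw [← intMulVec_mul, intMulVec_apply, intMulVec_apply, hE]
    simp only [Matrix.add_apply, Matrix.smul_apply, smul_eq_mul]
    push_cast
    ring
  have hdecomp : (a : ℤ_[p]) * intMulVec g y 0 + (b : ℤ_[p]) * intMulVec g y 1 =
      ((a : ℤ_[p]) * intMulVec h (intMulVec (s (ψ k)) y) 0 +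
        (b : ℤ_[p]) * intMulVec h (intMulVec (s (ψ k)) y) 1) +
      (p : ℤ_[p]) ^ ψ k * ((a : ℤ_[p]) * ((E 0 0 : ℤ_[p]) * y 0 + (E 0 1 : ℤ_[p]) * y 1) +
        (b : ℤ_[p]) * ((E 1 0 : ℤ_[p]) * y 0 + (E 1 1 : ℤ_[p]) * y 1)) := by
    rw [hvec 0, hvec 1]
    ring
  rw [hdecomp]
  refine (norm_add_le _ _).trans (add_le_add le_rfl ?_)
  rw [norm_mul, PadicInt.norm_p_pow, zpow_neg, zpow_natCast]
  simp only [Function.comp_apply, inv_pow]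
  exact mul_le_of_le_one_right (by positivity) (PadicInt.norm_le_one _)

theorem Frame.notMem_LMad {w : ℕ → ℕ} {n₀ a b N : ℕ} (F : Frame w n₀ a b)
    (hw : InAlphabet N w) (x : P1 p) : (w, x) ∉ LMad p := by
  intro hmem
  obtain ⟨y, δ, hδ, hbad⟩ := exists_badOn_of_mem_LMad hmem
  obtain ⟨xa, hxa, hTa⟩ := F.exists_trans_left letterUnit le_rfl
  obtain ⟨xb, hxb, hTb⟩ := F.symm.exists_trans_left letterUnit le_rfl
  have hrange : (Set.range fun i => letterUnit (w i)) = letterUnit '' Set.range w := by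
    rw [← Set.range_comp]
    rfl
  rw [hrange] at hxa hxb
  set ga := xa * letterUnit a
  set gb := xb * letterUnit b
  have hfin : ∀ k : ℕ, Finite (GL (Fin 2) (ZMod (p ^ k))) := fun k => by
    have : NeZero (p ^ k) := ⟨pow_ne_zero _ (Fact.out : p.Prime).ne_zero⟩
    have : Finite (Matrix (Fin 2) (Fin 2) (ZMod (p ^ k))) := by
      unfold Matrix
      infer_instance
    infer_instance
  obtain ⟨z, hz⟩ := exists_badOn_of_forall_congr
    (H := (Subgroup.closure {ga, gb} : Set (GL (Fin 2) ℤ))) hbad fun k => by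
      have := hfin k
      obtain ⟨s, hs⟩ := F.exists_cocycle_eq
        (Matrix.GeneralLinearGroup.map (Int.castRingHom (ZMod (p ^ k)))) hTa hTb
      refine ⟨cocycle letterUnit w s, fun h hh => ?_⟩
      obtain ⟨t, ht⟩ := hs h hh
      exact ⟨_, ⟨t, rfl⟩, by rw [ht, map_mul]⟩
  have := hfin 2
  -- `k + 1` is the order of GL₂(ℤ/p²), so every `(k + 1)`-st power is 1 modulo p².
  obtain ⟨k, hk⟩ := Nat.exists_eq_succ_of_ne_zero
    (Nat.card_pos (α := GL (Fin 2) (ZMod (p ^ 2)))).ne'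
  have hmap : ∀ g : GL (Fin 2) ℤ,
      Matrix.GeneralLinearGroup.map (Int.castRingHom (ZMod (p ^ 2))) (g ^ (k + 1)) = 1 := by
    intro g
    rw [map_pow, ← Nat.succ_eq_add_one, ← hk, pow_card_eq_one']
  have heig : ∀ g ∈ Subgroup.closure {ga, gb},
      z 0 * intMulVec (g ^ (k + 1)) z 1 - z 1 * intMulVec (g ^ (k + 1)) z 0 = 0 := by
    intro g hg
    by_contra hne
    exact not_badOn_of_not_eigenvector hδ (pow_mem hg _) (hmap g) hne hz
  have hcomm := commute_of_badOn hδ hz (heig ga (Subgroup.subset_closure (by simp)))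
    (heig gb (Subgroup.subset_closure (by simp)))
  have hS : ∀ c ∈ Set.range w, 1 ≤ c := by
    rintro _ ⟨i, rfl⟩
    exact (hw i).1
  obtain ⟨s, -, -, hsa⟩ := F.exists_isNext_eq_left le_rfl
  obtain ⟨s', -, -, hsb⟩ := F.symm.exists_isNext_eq_left le_rfl
  exact F.ne (letter_eq_of_commute hS ⟨s, hsa⟩ ⟨s', hsb⟩ hxa hxb k hcomm)

theorem notMem_LMad_of_complexity_le {w : ℕ → ℕ} {N : ℕ} (hw : InAlphabet N w)
    (hper : ¬ EventuallyPeriodic w) {B : ℕ} (hB : ∀ n, complexity w n ≤ n + B) (x : P1 p) :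
    (w, x) ∉ LMad p := by
  intro hmem
  obtain ⟨i, n₀, a, b, F⟩ := exists_frame_tail hw hper hB
  obtain ⟨x', hx'⟩ := mem_LMad_tail hmem i
  exact F.notMem_LMad (hw.tail i) x' hx'

end

end LimitMad

theorem theorem2p3 (p : ℕ) [Fact p.Prime] (N : ℕ) (w : ℕ → ℕ) (hw : LimitMad.InAlphabet N w) :
    (¬ LimitMad.EventuallyPeriodic w →
      (∃ C : ℝ, 0 < C ∧ ∀ n : ℕ, 1 ≤ n → (LimitMad.complexity w n : ℝ) ≤ n + C) →
        ∀ x : LimitMad.P1 p, (w, x) ∉ LimitMad.LMad p) ∧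
    (LimitMad.IsSturmian w → ∀ x : LimitMad.P1 p, (w, x) ∉ LimitMad.LMad p) := by
  constructor
  · rintro hper ⟨C, hC, h⟩ x
    refine LimitMad.notMem_LMad_of_complexity_le hw hper (B := ⌈C⌉₊) (fun n => ?_) x
    -- The hypothesis omits length 0; there the complexity is 1, which is at most `⌈C⌉₊` because `C`
    -- is positive.
    rcases Nat.eq_zero_or_pos n with rfl | hn
    · rw [LimitMad.complexity_zero, zero_add]
      exact Nat.ceil_pos.2 hC
    · have h1 := (h n hn).trans (add_le_add le_rfl (Nat.le_ceil C))
      exact_mod_cast h1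
  · intro hst x
    refine LimitMad.notMem_LMad_of_complexity_le hw (fun hper => ?_) (B := 1)
      (fun n => (hst n).le) x
    obtain ⟨B, hB⟩ := hper.exists_complexity_le
    have := hB B
    rw [hst B] at this
    omega
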